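/- For a Boolean circuit $f:\{0,1\}^n\to\{0,1\}$ over AND, OR, NOT let $gap(f)=\sum_{x\in\{0,1\}^n}(-1)^{f(x)}$. Consider the following conjecture: for every constant $a>0$ there is a polynomial $p$ such that, if $A$ is a non-deterministic $T(n)$-time algorithm which, given (a description of) a Boolean circuit $f:\{0,1\}^n\to\{0,1\}$ with at most $p(n)$ gates, accepts if $gap(f)\ne0$ and rejects if $gap(f)=0$, then $T(n)>2^{(1-a)n}$ for infinitely many $n$. An $N$-qubit HC1Q model is given by a classical reversible circuit $C$ on $N$ bits consisting of NOT and TOFFOLI gates, a set of measured qubits and a measurement result: the operation $(H^{\otimes N-1}\otimes I)\,C\,(H^{\otimes N-1}\otimes I)$ is applied to $|0^N\rangle$, the chosen qubits are measured in the computational basis, and the acceptance probability $p_{acc}$ is the probability of the given result. A classical probabilistic algorithm, given a description of the model, samples $p_{acc}$ in time $T$ within a multiplicative error $\epsilon$ if all its computation paths halt within time $T$ and its acceptance probability $q_{acc}$ satisfies $|p_{acc}-q_{acc}|\le\epsilon\,p_{acc}$. Theorem. Assume that the conjecture is true. Then for every constant $a>0$ there is a polynomial $q$ such that for every $\epsilon<1$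 and every classical probabilistic algorithm $S$ the following holds for infinitely many $n$. There are a Boolean circuit $f:\{0,1\}^n\to\{0,1\}$ with at most $q(n)$ gates, a natural number $\xi$, and an $N$-qubit HC1Q model with $N=n+\xi+2\le q(n)$ and with a reversible circuit of at most $q(n)$ gates, such that its acceptance probability is $$p_{acc}=\frac{gap(f)^2}{2^{2n+2\xi}},$$ and $S$ does not sample $p_{acc}$ in time $2^{(1-a)n}$ within the multiplicative error $\epsilon$. -/

import Mathlib

open Filter MeasureTheory

namespace FineGrained

/-! ### Classical algorithms

Algorithms are programs of a structured language over binary trees with unit-cost elementary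
operations and a coin-tossing instruction.  With shared representation of trees every operation
is a constant number of pointer operations, and a random access machine is simulated with
polylogarithmic overhead.  The same programs are read as probabilistic algorithms (the tosses are
independent and fair) and as non-deterministic algorithms (the tosses are guesses). -/

/-- Binary trees, the data on which programs operate. -/
inductive Data : Type
  | nil : Data
  | cons : Data → Data → Data

namespace Data

/-- First component (the empty tree has components `nil`). -/
def hd : Data → Data
  | nil => nil
  | cons a _ => a

/-- Second component. -/
def tl : Data → Data
  | nil => nil
  | cons _ b => b

/-- Unary notation for natural numbers. -/
def ofNat : ℕ → Data
  | 0 => nil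
  | k + 1 => cons nil (ofNat k)

/-- The list of given trees. -/
def ofList : List Data → Data
  | [] => nil
  | d :: l => cons d (ofList l)

/-- A truth value: `false` is the empty tree. -/
def ofBool : Bool → Data
  | false => nil
  | true => cons nil nil

end Data

/-- The contents of the program variables. -/
abbrev Store := ℕ → Data

/-- Expressions. -/
inductive Expr : Type
  | var : ℕ → Expr
  | nil : Expr
  | cons : Expr → Expr → Expr
  | hd : Expr → Expr
  | tl : Expr → Expr

namespace Expr

/-- Value of an expression. -/
def eval : Expr → Store → Data
  | var x, s => s x
  | nil, _ => Data.nil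
  | cons e₁ e₂, s => Data.cons (e₁.eval s) (e₂.eval s)
  | hd e, s => (e.eval s).hd
  | tl e, s => (e.eval s).tl

/-- Number of elementary operations in the evaluation of an expression. -/
def cost : Expr → ℕ
  | var _ => 1
  | nil => 1
  | cons e₁ e₂ => e₁.cost + e₂.cost + 1
  | hd e => e.cost + 1
  | tl e => e.cost + 1

end Expr

/-- Programs. `ite e c₁ c₂` tests whether `e` is not `nil`, `loop e c` repeats `c` as long as `e`
is not `nil`, and `flip x` stores a coin toss in the variable `x`. -/
inductive Prog : Type
  | skip : Prog
  | assign : ℕ → Expr → Prog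
  | flip : ℕ → Prog
  | seq : Prog → Prog → Prog
  | ite : Expr → Prog → Prog → Prog
  | loop : Expr → Prog → Prog

namespace Prog

/-- `Run ω c s i s₁ j t`: if the successive coin tosses are `ω 0, ω 1, …`, of which the first `i`
have already been used, then the program `c`, started in the store `s`, halts after exactly `t`
steps in the store `s₁`, when the first `j` tosses have been used. -/
inductive Run (ω : ℕ → Bool) : Prog → Store → ℕ → Store → ℕ → ℕ → Prop
  | skip (s : Store) (i : ℕ) : Run ω skip s i s i 1
  | assign (x : ℕ) (e : Expr) (s : Store) (i : ℕ) :
      Run ω (assign x e) s i (Function.update s x (e.eval s)) i (e.cost + 1)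
  | flip (x : ℕ) (s : Store) (i : ℕ) :
      Run ω (flip x) s i (Function.update s x (Data.ofBool (ω i))) (i + 1) 1
  | seq {c₁ c₂ : Prog} {s s₁ s₂ : Store} {i j k t₁ t₂ : ℕ} :
      Run ω c₁ s i s₁ j t₁ → Run ω c₂ s₁ j s₂ k t₂ → Run ω (seq c₁ c₂) s i s₂ k (t₁ + t₂)
  | ite_true {e : Expr} {c₁ c₂ : Prog} {s s₁ : Store} {i j t : ℕ} :
      e.eval s ≠ Data.nil → Run ω c₁ s i s₁ j t → Run ω (ite e c₁ c₂) s i s₁ j (e.cost + 1 + t)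
  | ite_false {e : Expr} {c₁ c₂ : Prog} {s s₁ : Store} {i j t : ℕ} :
      e.eval s = Data.nil → Run ω c₂ s i s₁ j t → Run ω (ite e c₁ c₂) s i s₁ j (e.cost + 1 + t)
  | loop_done {e : Expr} {c : Prog} {s : Store} {i : ℕ} :
      e.eval s = Data.nil → Run ω (loop e c) s i s i (e.cost + 1)
  | loop_step {e : Expr} {c : Prog} {s s₁ s₂ : Store} {i j k t₁ t₂ : ℕ} :
      e.eval s ≠ Data.nil → Run ω c s i s₁ j t₁ → Run ω (loop e c) s₁ j s₂ k t₂ →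
      Run ω (loop e c) s i s₂ k (e.cost + 1 + t₁ + t₂)

/-- The initial store: the input is in variable `0`, all other variables hold `nil`. -/
def init (d : Data) : Store := fun x => if x = 0 then d else Data.nil

/-- With the coin tosses `ω`, the program halts on the input `d` and accepts, that is, variable
`0` is not `nil` at the end. -/
def AcceptsWith (c : Prog) (d : Data) (ω : ℕ → Bool) : Prop :=
  ∃ (s : Store) (j t : ℕ), Run ω c (init d) 0 s j t ∧ s 0 ≠ Data.nil

/-- On the input `d`, every computation path of the program halts within `T` steps. -/
def HaltsWithin (c : Prog) (d : Data) (T : ℝ) : Prop :=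
  ∀ ω : ℕ → Bool, ∃ (s : Store) (j t : ℕ), Run ω c (init d) 0 s j t ∧ (t : ℝ) ≤ T

/-- Non-deterministic acceptance: some computation path accepts. -/
def NAccepts (c : Prog) (d : Data) : Prop := ∃ ω : ℕ → Bool, c.AcceptsWith d ω

/-- The law of an infinite sequence of independent fair coin tosses. -/
noncomputable def coinMeasure : Measure (ℕ → Bool) :=
  Measure.infinitePi fun _ => (PMF.uniformOfFintype Bool).toMeasure

/-- Probability that the program accepts the input `d`, for independent fair coin tosses. -/
noncomputable def acceptProb (c : Prog) (d : Data) : ℝ :=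
  coinMeasure.real {ω | c.AcceptsWith d ω}

/-- On the input `d`, the program samples the acceptance probability `p` in time `T` within the
multiplicative error `ε`. -/
def Samples (c : Prog) (d : Data) (p T ε : ℝ) : Prop :=
  c.HaltsWithin d T ∧ |p - c.acceptProb d| ≤ ε * p

end Prog

/-! ### Boolean circuits and the gap function -/

/-- A Boolean gate whose inputs are among `m` wires. -/
inductive BoolGate (m : ℕ) : Type
  | and : Fin m → Fin m → BoolGate m
  | or : Fin m → Fin m → BoolGate m
  | not : Fin m → BoolGate m

namespace BoolGate

/-- The output of a gate, given the values of the wires. -/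
def eval {m : ℕ} (v : Fin m → Bool) : BoolGate m → Bool
  | and i j => v i && v j
  | or i j => v i || v j
  | not i => !v i

/-- Description of a gate: its type, followed by its input wires. -/
def encode {m : ℕ} : BoolGate m → Data
  | and i j => Data.cons (Data.ofNat 0) (Data.cons (Data.ofNat i) (Data.ofNat j))
  | or i j => Data.cons (Data.ofNat 1) (Data.cons (Data.ofNat i) (Data.ofNat j))
  | not i => Data.cons (Data.ofNat 2) (Data.ofNat i)

end BoolGate

/-- A sequence of `k` gates on `n` input wires. The wires `0, …, n - 1` carry the inputs, the wire
`n + l` carries the output of the gate number `l`, and every gate reads earlier wires only. -/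
inductive BoolGates (n : ℕ) : ℕ → Type
  | empty : BoolGates n 0
  | snoc {k : ℕ} : BoolGates n k → BoolGate (n + k) → BoolGates n (k + 1)

namespace BoolGates

/-- The values of all wires on the input `x`. -/
def wires {n : ℕ} (x : Fin n → Bool) : {k : ℕ} → BoolGates n k → Fin (n + k) → Bool
  | _, empty => x
  | _, snoc g b => Fin.snoc (α := fun _ => Bool) (g.wires x) (b.eval (g.wires x))

/-- Description of a sequence of gates: the list of the gates, the last gate first. -/
def encode {n : ℕ} : {k : ℕ} → BoolGates n k → Data
  | _, empty => Data.nil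
  | _, snoc g b => Data.cons b.encode g.encode

end BoolGates

/-- A Boolean circuit with `n` input bits and one output bit, over AND, OR and NOT with unbounded
fan-out; `size` is the number of gates. -/
structure BoolCircuit (n : ℕ) where
  size : ℕ
  gates : BoolGates n size
  out : Fin (n + size)

namespace BoolCircuit

/-- The Boolean function computed by the circuit. -/
def eval {n : ℕ} (f : BoolCircuit n) (x : Fin n → Bool) : Bool := f.gates.wires x f.out

/-- The gap, the sum of `(-1) ^ f x` over all inputs `x`. -/
def gap {n : ℕ} (f : BoolCircuit n) : ℤ := ∑ x : Fin n → Bool, (-1) ^ (f.eval x).toNat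

/-- Description of a circuit: number of inputs, gates, output wire. -/
def encode {n : ℕ} (f : BoolCircuit n) : Data :=
  Data.cons (Data.ofNat n) (Data.cons f.gates.encode (Data.ofNat f.out))

end BoolCircuit

/-- The fine-grained hardness conjecture for the gap of polynomial-size Boolean circuits. For
every `a > 0` there is a polynomial size bound `p` such that a non-deterministic `T(n)`-time
algorithm which, given a Boolean circuit `f` with `n` inputs and at most `p(n)` gates, accepts if
the gap of `f` is nonzero and rejects if it is zero, has `T(n) > 2 ^ ((1 - a) n)` for infinitely
many `n`. -/
def GapConjecture : Prop :=
  ∀ a : ℝ, 0 < a → ∃ p : Polynomial ℕ, ∀ (A : Prog) (T : ℕ → ℝ),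
    (∀ (n : ℕ) (f : BoolCircuit n), f.size ≤ p.eval n →
      A.HaltsWithin f.encode (T n) ∧ (A.NAccepts f.encode ↔ f.gap ≠ 0)) →
    ∃ᶠ n : ℕ in atTop, (2 : ℝ) ^ ((1 - a) * (n : ℝ)) < T n

/-! ### The HC1Q model -/

/-- The reversible gates NOT and TOFFOLI on `N` bits; `toffoli i j k` has the controls `i`, `j`
and the target `k`. -/
inductive RevGate (N : ℕ) : Type
  | not : Fin N → RevGate N
  | toffoli (i j k : Fin N) : i ≠ j → i ≠ k → j ≠ k → RevGate N

namespace RevGate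

/-- Action of a gate on bit strings. -/
def apply {N : ℕ} : RevGate N → (Fin N → Bool) → (Fin N → Bool)
  | not i, x => Function.update x i (!x i)
  | toffoli i j k _ _ _, x => Function.update x k (xor (x k) (x i && x j))

/-- Description of a gate: its type, followed by its bits. -/
def encode {N : ℕ} : RevGate N → Data
  | not i => Data.cons (Data.ofNat 0) (Data.ofNat i)
  | toffoli i j k _ _ _ =>
      Data.cons (Data.ofNat 1) (Data.cons (Data.ofNat i) (Data.cons (Data.ofNat j) (Data.ofNat k)))

end RevGate

/-- The map on bit strings computed by a reversible circuit, the head of the list being the first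
gate that is applied. -/
def revApply {N : ℕ} (C : List (RevGate N)) (x : Fin N → Bool) : Fin N → Bool :=
  C.foldl (fun y g => g.apply y) x

/-- The matrix of a reversible circuit, applied coherently, in the computational basis. -/
noncomputable def revMatrix {N : ℕ} (C : List (RevGate N)) :
    Matrix (Fin N → Bool) (Fin N → Bool) ℂ :=
  fun y x => if y = revApply C x then 1 else 0

/-- Matrix entries of the one-qubit Hadamard gate. -/
noncomputable def hadamard : Matrix Bool Bool ℂ :=
  fun b c => (1 / (Real.sqrt 2 : ℂ)) * (if b && c then -1 else 1)

/-- The Hadamard gate on each of the first `N - 1` qubits, tensored with the identity on the last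
qubit. -/
noncomputable def hadamardLayer (N : ℕ) : Matrix (Fin N → Bool) (Fin N → Bool) ℂ :=
  fun y x => ∏ i : Fin N,
    if (i : ℕ) + 1 < N then hadamard (y i) (x i) else (1 : Matrix Bool Bool ℂ) (y i) (x i)

/-- The basis state in which all qubits are `0`. -/
noncomputable def ketZero (N : ℕ) : (Fin N → Bool) → ℂ :=
  Pi.single (fun _ => false) 1

/-- An `N`-qubit HC1Q model: a reversible circuit, the set of the measured qubits (those `i` with
`accept i ≠ none`) and the measurement result on which the model accepts. -/
structure HC1Q (N : ℕ) where
  circuit : List (RevGate N)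
  accept : Fin N → Option Bool

namespace HC1Q

/-- The final state `(H ⊗ ⋯ ⊗ H ⊗ I) C (H ⊗ ⋯ ⊗ H ⊗ I) |0⋯0⟩`. -/
noncomputable def finalState {N : ℕ} (Q : HC1Q N) : (Fin N → Bool) → ℂ :=
  (hadamardLayer N * revMatrix Q.circuit * hadamardLayer N).mulVec (ketZero N)

open Classical in
/-- The acceptance probability: the probability that each measured qubit `i` yields the result
prescribed by `accept i`. -/
noncomputable def acceptProb {N : ℕ} (Q : HC1Q N) : ℝ :=
  ∑ y : Fin N → Bool,
    if ∀ i : Fin N, ∀ b : Bool, Q.accept i = some b → y i = b then ‖Q.finalState y‖ ^ 2 else 0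

/-- Description of the accepted result at one qubit (`none` means that it is not measured). -/
def encodeResult : Option Bool → Data
  | none => Data.ofNat 0
  | some false => Data.ofNat 1
  | some true => Data.ofNat 2

/-- Description of an HC1Q model: number of qubits, list of the gates, list of the accepted
results. -/
def encode {N : ℕ} (Q : HC1Q N) : Data :=
  Data.cons (Data.ofNat N)
    (Data.cons (Data.ofList (Q.circuit.map RevGate.encode))
      (Data.ofList (List.ofFn fun i => encodeResult (Q.accept i))))

end HC1Q

end FineGrained

open FineGrained

/-! The argument is a reduction. If |p - q| ≤ ε p with ε < 1, then q vanishes exactly when p does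
(`Prog.Samples.nAccepts_iff`). A halting run reads finitely many tosses, so the acceptance
probability is positive exactly when some sequence of tosses leads to acceptance
(`Prog.acceptProb_ne_zero_iff`). Hence a sampler for a multiple of gap(f)², with its tosses read as
guesses, decides whether gap(f) ≠ 0.

The construction must give exactly gap(f)² / 2^(2n+2ξ), although every qubit but the last starts in
a uniform superposition, so that there are no clean work bits. The last qubit, initially 0, serves
as a flag: it becomes 1 only on the branches where all work wires and the phase wire happen to be 1,
and measuring it as 1 discards all other branches. The conjunction is computed by Toffoli gates that
borrow bits in unknown states (`wireAct_multiNot`, `wireAct_flagCircuit`): two halves of the work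
wires lend to each other, and one extra wire stays unconstrained. On the surviving branches the work
wires act as bits initialized to 1, and f is evaluated into the phase wire
(`BoolCircuit.wireAct_compile`). Measuring the phase wire as 1 after its Hadamard gate contributes
(-1)^f(x) up to a global sign; the other Hadamard qubits, measured as 0, contribute constants. The
amplitude is therefore -gap(f) / 2^(n+ξ) with ξ = 2k+3 for k gates (`BoolCircuit.acceptProb_model`).

An explicit program writes down the model in time linear in n + k (`Prog.transforms_writeModel`). If
S sampled correctly for all n ≥ n₀, then this program followed by S, preceded by a finite table for
the circuits with n < n₀, would decide the gap (`exists_prog_of_samples`). Its overhead is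
polynomial and is absorbed by passing from a to a smaller exponent, which contradicts the
conjecture. -/

namespace FineGrained

/-! ### Determinism of runs, positive acceptance probability, and timing rules. -/

namespace Prog

/-- Once the tosses are fixed nothing is left to choice. This lets acceptance be read off from any
one halting run. -/
theorem Run.det {ω : ℕ → Bool} {c : Prog} {s s₁ s₂ : Store} {i j₁ j₂ t₁ t₂ : ℕ}
    (h₁ : Run ω c s i s₁ j₁ t₁) (h₂ : Run ω c s i s₂ j₂ t₂) : s₁ = s₂ ∧ j₁ = j₂ ∧ t₁ = t₂ := by
  induction h₁ generalizing s₂ j₂ t₂ with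
  | skip s i => cases h₂; simp
  | assign x e s i => cases h₂; simp
  | flip x s i => cases h₂; simp
  | seq _ _ ih₁ ih₂ =>
    cases h₂ with
    | seq h h' =>
      obtain ⟨rfl, rfl, rfl⟩ := ih₁ h
      obtain ⟨rfl, rfl, rfl⟩ := ih₂ h'
      simp
  | ite_true he _ ih =>
    cases h₂ with
    | ite_true _ h => obtain ⟨rfl, rfl, rfl⟩ := ih h; simp
    | ite_false he' _ => exact absurd he' he
  | ite_false he _ ih =>
    cases h₂ with
    | ite_true he' _ => exact absurd he he'
    | ite_false _ h => obtain ⟨rfl, rfl, rfl⟩ := ih h; simp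
  | loop_done he =>
    cases h₂ with
    | loop_done _ => simp
    | loop_step he' _ _ => exact absurd he he'
  | loop_step he _ _ ih₁ ih₂ =>
    cases h₂ with
    | loop_done he' => exact absurd he' he
    | loop_step _ h h' =>
      obtain ⟨rfl, rfl, rfl⟩ := ih₁ h
      obtain ⟨rfl, rfl, rfl⟩ := ih₂ h'
      simp

theorem Run.tosses_le {ω : ℕ → Bool} {c : Prog} {s s₁ : Store} {i j t : ℕ}
    (h : Run ω c s i s₁ j t) : i ≤ j := by
  induction h with
  | skip | assign | flip | loop_done => omega
  | ite_true _ _ ih | ite_false _ _ ih => exact ih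
  | seq _ _ ih₁ ih₂ | loop_step _ _ _ ih₁ ih₂ => exact ih₁.trans ih₂

/-- A run depends only on the tosses that it uses. -/
theorem Run.congr_tosses {ω ω' : ℕ → Bool} {c : Prog} {s s₁ : Store} {i j t : ℕ}
    (h : Run ω c s i s₁ j t) (hω : ∀ l < j, ω' l = ω l) : Run ω' c s i s₁ j t := by
  induction h with
  | skip s i => exact .skip s i
  | assign x e s i => exact .assign x e s i
  | flip x s i =>
    have := Run.flip (ω := ω') x s i
    rwa [hω i (by omega)] at this
  | seq h₁ h₂ ih₁ ih₂ =>
    exact .seq (ih₁ fun l hl => hω l (hl.trans_le h₂.tosses_le)) (ih₂ hω)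
  | ite_true he _ ih => exact .ite_true he (ih hω)
  | ite_false he _ ih => exact .ite_false he (ih hω)
  | loop_done he => exact .loop_done he
  | loop_step he h₁ h₂ ih₁ ih₂ =>
    exact .loop_step he (ih₁ fun l hl => hω l (hl.trans_le h₂.tosses_le)) (ih₂ hω)

instance : IsProbabilityMeasure coinMeasure := by
  unfold coinMeasure; infer_instance

/-- A finite prefix of tosses has probability a finite product of factors 1/2. -/
theorem coinMeasure_cylinder_pos (ω : ℕ → Bool) (j : ℕ) :
    0 < coinMeasure {ω' | ∀ l < j, ω' l = ω l} := by
  have h : {ω' : ℕ → Bool | ∀ l < j, ω' l = ω l} =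
      Set.pi (Finset.range j : Set ℕ) fun l => {ω l} := by
    ext; simp [Set.mem_pi]
  rw [h, coinMeasure, Measure.infinitePi_pi _ (fun _ _ => MeasurableSet.singleton _)]
  refine pos_iff_ne_zero.2 (Finset.prod_ne_zero_iff.2 fun l _ => ?_)
  rw [PMF.toMeasure_apply_singleton _ _ (MeasurableSet.singleton _)]
  simp

/-- A program accepts with positive probability exactly if some computation path accepts. -/
theorem acceptProb_ne_zero_iff (c : Prog) (d : Data) : c.acceptProb d ≠ 0 ↔ c.NAccepts d := by
  constructor
  · intro h
    by_contra hn
    refine h ?_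
    have : {ω | c.AcceptsWith d ω} = ∅ :=
      Set.eq_empty_of_forall_notMem fun ω hω => hn ⟨ω, hω⟩
    simp [acceptProb, this]
  · rintro ⟨ω, s, j, t, hr, hs⟩
    have hsub : {ω' | ∀ l < j, ω' l = ω l} ⊆ {ω | c.AcceptsWith d ω} := fun ω' hω' =>
      ⟨s, j, t, hr.congr_tosses hω', hs⟩
    have h := (coinMeasure_cylinder_pos ω j).trans_le (measure_mono hsub)
    exact (ENNReal.toReal_pos h.ne' (measure_ne_top _ _)).ne'

/-- For an error below one, the sampled probability vanishes exactly if no path accepts. -/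
theorem Samples.nAccepts_iff {c : Prog} {d : Data} {p T ε : ℝ} (h : c.Samples d p T ε)
    (hp : 0 ≤ p) (hε : ε < 1) : c.NAccepts d ↔ p ≠ 0 := by
  rw [← acceptProb_ne_zero_iff]
  have h2 := h.2
  constructor
  · rintro hq rfl
    simp at h2
    exact hq h2
  · intro hp0 hq
    rw [hq, sub_zero, abs_of_nonneg hp] at h2
    -- A vanishing sampled probability would give p ≤ ε p, which is impossible for p > 0 and ε < 1.
    have : 0 < p := lt_of_le_of_ne hp hp0.symm
    nlinarith

/-- Without coin tosses, the program `c` turns the input `d` into `d'` within `T` steps, and leaves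
no other variable occupied. -/
def Transforms (c : Prog) (d d' : Data) (T : ℕ) : Prop :=
  ∀ (ω : ℕ → Bool) (i : ℕ), ∃ t ≤ T, Run ω c (init d) i (init d') i t

theorem update_init (d d' : Data) : Function.update (init d) 0 d' = init d' := by
  funext x
  by_cases h : x = 0 <;> simp [init, h]

namespace Transforms

theorem mono {c : Prog} {d d' : Data} {T T' : ℕ} (h : c.Transforms d d' T) (hT : T ≤ T') :
    c.Transforms d d' T' := fun ω i =>
  let ⟨t, ht, hr⟩ := h ω i
  ⟨t, ht.trans hT, hr⟩

theorem assign {e : Expr} {d d' : Data} {T : ℕ} (h : e.eval (init d) = d') (hT : e.cost + 1 ≤ T) :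
    (Prog.assign 0 e).Transforms d d' T := fun ω i =>
  ⟨_, hT, by have := Run.assign (ω := ω) 0 e (init d) i; rwa [h, update_init] at this⟩

theorem seq {c₁ c₂ : Prog} {d d' d'' : Data} {T₁ T₂ : ℕ} (h₁ : c₁.Transforms d d' T₁)
    (h₂ : c₂.Transforms d' d'' T₂) : (Prog.seq c₁ c₂).Transforms d d'' (T₁ + T₂) := fun ω i =>
  let ⟨_, ht₁, hr₁⟩ := h₁ ω i
  let ⟨_, ht₂, hr₂⟩ := h₂ ω i
  ⟨_, add_le_add ht₁ ht₂, .seq hr₁ hr₂⟩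

theorem ite_true {e : Expr} {c₁ c₂ : Prog} {d d' : Data} {T : ℕ} (he : e.eval (init d) ≠ Data.nil)
    (h : c₁.Transforms d d' T) : (Prog.ite e c₁ c₂).Transforms d d' (e.cost + 1 + T) := fun ω i =>
  let ⟨_, ht, hr⟩ := h ω i
  ⟨_, add_le_add_right ht _, .ite_true he hr⟩

theorem ite_false {e : Expr} {c₁ c₂ : Prog} {d d' : Data} {T : ℕ} (he : e.eval (init d) = Data.nil)
    (h : c₂.Transforms d d' T) : (Prog.ite e c₁ c₂).Transforms d d' (e.cost + 1 + T) := fun ω i =>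
  let ⟨_, ht, hr⟩ := h ω i
  ⟨_, add_le_add_right ht _, .ite_false he hr⟩

theorem loop_done {e : Expr} {c : Prog} {d : Data} (he : e.eval (init d) = Data.nil) :
    (Prog.loop e c).Transforms d d (e.cost + 1) := fun _ _ =>
  ⟨_, le_rfl, .loop_done he⟩

theorem loop_step {e : Expr} {c : Prog} {d d' d'' : Data} {T₁ T₂ : ℕ}
    (he : e.eval (init d) ≠ Data.nil) (h₁ : c.Transforms d d' T₁)
    (h₂ : (Prog.loop e c).Transforms d' d'' T₂) :
    (Prog.loop e c).Transforms d d'' (e.cost + 1 + T₁ + T₂) := fun ω i =>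
  let ⟨_, ht₁, hr₁⟩ := h₁ ω i
  let ⟨_, ht₂, hr₂⟩ := h₂ ω i
  ⟨_, by omega, .loop_step he hr₁ hr₂⟩

end Transforms

/-! ### Programs with a hard-coded table -/

/-- Run `c₁` if the value of `e` is the tree `D`, and `c₂` otherwise. -/
def ifEq : Data → Expr → Prog → Prog → Prog
  | Data.nil, e, c₁, c₂ => ite e c₂ c₁
  | Data.cons a b, e, c₁, c₂ => ite e (ifEq a e.hd (ifEq b e.tl c₁ c₂) c₂) c₂

/-- The test descends along the fixed tree `D`, so its cost has a bound independent of the value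
tested and of both branches. It leaves the store untouched. -/
theorem run_ifEq (D : Data) (e : Expr) : ∃ T : ℕ, ∀ (c₁ c₂ : Prog) (ω : ℕ → Bool) (s s' : Store)
    (i j t : ℕ),
    (e.eval s = D → Run ω c₁ s i s' j t) → (e.eval s ≠ D → Run ω c₂ s i s' j t) →
    ∃ t' ≤ t + T, Run ω (ifEq D e c₁ c₂) s i s' j t' := by
  induction D generalizing e with
  | nil =>
    refine ⟨e.cost + 1, fun c₁ c₂ ω s s' i j t h₁ h₂ => ⟨e.cost + 1 + t, by omega, ?_⟩⟩
    by_cases h : e.eval s = Data.nil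
    · exact .ite_false h (h₁ h)
    · exact .ite_true h (h₂ h)
  | cons a b iha ihb =>
    obtain ⟨Ta, ha⟩ := iha e.hd
    obtain ⟨Tb, hb⟩ := ihb e.tl
    refine ⟨e.cost + 1 + Ta + Tb, fun c₁ c₂ ω s s' i j t h₁ h₂ => ?_⟩
    cases h : e.eval s with
    | nil =>
      exact ⟨e.cost + 1 + t, by omega, .ite_false h (h₂ (by simp [h]))⟩
    | cons x y =>
      have hx : e.hd.eval s = x := by simp [Expr.eval, h, Data.hd]
      have hy : e.tl.eval s = y := by simp [Expr.eval, h, Data.tl]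
      by_cases hxa : x = a
      · obtain ⟨t₁, ht₁, hr₁⟩ := hb c₁ c₂ ω s s' i j t
          (fun hh => h₁ (by rw [h, hxa, ← hy, hh]))
          (fun hh => h₂ (by rw [h]; rintro ⟨⟩; exact hh hy))
        obtain ⟨t₂, ht₂, hr₂⟩ := ha (ifEq b e.tl c₁ c₂) c₂ ω s s' i j t₁ (fun _ => hr₁)
          (fun hh => absurd (hx.trans hxa) hh)
        exact ⟨e.cost + 1 + t₂, by omega, .ite_true (by simp [h]) hr₂⟩
      · obtain ⟨t₂, ht₂, hr₂⟩ := ha (ifEq b e.tl c₁ c₂) c₂ ω s s' i j t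
          (fun hh => absurd (hx.symm.trans hh) hxa)
          (fun _ => h₂ (by rw [h]; rintro ⟨⟩; exact hxa rfl))
        exact ⟨e.cost + 1 + t₂, by omega, .ite_true (by simp [h]) hr₂⟩

/-- Answer the inputs in the list `l` as prescribed by `ans`, and run `c` on all others. -/
def table (ans : Data → Bool) (l : List Data) (c : Prog) : Prog :=
  l.foldr (fun D c' => ifEq D (.var 0) (assign 0 (if ans D then .cons .nil .nil else .nil)) c') c

/-- The overhead `T` depends on the table alone, hence is constant in the input. The function `ans`
need not be computable, because only its finitely many values on `l` enter the program. -/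
theorem run_table (ans : Data → Bool) (l : List Data) (c : Prog) :
    ∃ T : ℕ, ∀ (d : Data) (ω : ℕ → Bool) (i : ℕ),
      (d ∈ l → ∃ t ≤ T, Run ω (table ans l c) (init d) i (init (Data.ofBool (ans d))) i t) ∧
      (d ∉ l → ∀ (s' : Store) (j t : ℕ), Run ω c (init d) i s' j t →
        ∃ t' ≤ t + T, Run ω (table ans l c) (init d) i s' j t') := by
  induction l with
  | nil => exact ⟨0, fun d ω i => ⟨by simp, fun _ s' j t h => ⟨t, by simp, h⟩⟩⟩
  | cons D l ih =>
    obtain ⟨T, ih⟩ := ih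
    obtain ⟨T', hT'⟩ := run_ifEq D (.var 0)
    refine ⟨T + T' + 4, fun d ω i => ⟨fun hd => ?_, fun hd s' j t h => ?_⟩⟩
    · by_cases hD : d = D
      · subst hD
        have hrun : ∃ t ≤ 4, Run ω (assign 0 (if ans d then .cons .nil .nil else .nil)) (init d) i
            (init (Data.ofBool (ans d))) i t := by
          refine Transforms.assign ?_ ?_ ω i <;>
            cases ans d <;> simp [Expr.eval, Expr.cost, Data.ofBool]
        obtain ⟨t, ht, hr⟩ := hrun
        obtain ⟨t', ht', hr'⟩ := hT' _ (table ans l c) ω (init d) _ i i t (fun _ => hr)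
          (fun h => absurd rfl h)
        exact ⟨t', by omega, hr'⟩
      · obtain ⟨t, ht, hr⟩ := (ih d ω i).1 ((List.mem_cons.1 hd).resolve_left hD)
        obtain ⟨t', ht', hr'⟩ := hT' (assign 0 (if ans D then .cons .nil .nil else .nil))
          (table ans l c) ω (init d) _ i i t (fun h => absurd h hD) (fun _ => hr)
        exact ⟨t', by omega, hr'⟩
    · rw [List.mem_cons, not_or] at hd
      obtain ⟨t₁, ht₁, hr₁⟩ := (ih d ω i).2 hd.2 s' j t h
      obtain ⟨t', ht', hr'⟩ := hT' (assign 0 (if ans D then .cons .nil .nil else .nil))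
          (table ans l c) ω (init d) s' i j t₁ (fun h => absurd h hd.1) (fun _ => hr₁)
      exact ⟨t', by omega, hr'⟩

end Prog

/-! ### Reversible gates on wires indexed by natural numbers -/

/-- NOT and TOFFOLI gates, without side conditions on the wires. -/
inductive WireGate : Type
  | not : ℕ → WireGate
  | tof : ℕ → ℕ → ℕ → WireGate

namespace WireGate

/-- The wire that a gate changes. -/
def target : WireGate → ℕ
  | not i => i
  | tof _ _ k => k

/-- Whether a gate flips its target. -/
def fires : WireGate → (ℕ → Bool) → Bool
  | not _, _ => true
  | tof i j _, s => s i && s j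

/-- Action on the values of the wires. -/
def act (g : WireGate) (s : ℕ → Bool) : ℕ → Bool :=
  Function.update s g.target (xor (s g.target) (g.fires s))

/-- The wires of a gate are distinct and among the first `N`. -/
def Valid (N : ℕ) : WireGate → Prop
  | not i => i < N
  | tof i j k => i < N ∧ j < N ∧ k < N ∧ i ≠ j ∧ i ≠ k ∧ j ≠ k

instance (N : ℕ) : DecidablePred (Valid N)
  | not _ => inferInstanceAs (Decidable (_ < _))
  | tof _ _ _ => inferInstanceAs (Decidable (_ ∧ _))

/-- Description of a gate. -/
def encode : WireGate → Data
  | not i => Data.cons (Data.ofNat 0) (Data.ofNat i)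
  | tof i j k =>
      Data.cons (Data.ofNat 1) (Data.cons (Data.ofNat i) (Data.cons (Data.ofNat j) (Data.ofNat k)))

/-- A valid gate as a gate on `N` bits. -/
def toRev {N : ℕ} : (g : WireGate) → g.Valid N → RevGate N
  | not i, h => .not ⟨i, h⟩
  | tof i j k, h => .toffoli ⟨i, h.1⟩ ⟨j, h.2.1⟩ ⟨k, h.2.2.1⟩
      (by simpa using h.2.2.2.1) (by simpa using h.2.2.2.2.1) (by simpa using h.2.2.2.2.2)

theorem encode_toRev {N : ℕ} (g : WireGate) (h : g.Valid N) : (g.toRev h).encode = g.encode := by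
  cases g <;> rfl

theorem apply_toRev {N : ℕ} (g : WireGate) (h : g.Valid N) (s : ℕ → Bool) :
    (g.toRev h).apply (fun i : Fin N => s i) = fun i : Fin N => g.act s i := by
  cases g <;>
  · funext l
    simp [toRev, RevGate.apply, act, Function.update_apply, target, fires, Fin.ext_iff]

theorem act_of_ne (g : WireGate) (s : ℕ → Bool) {i : ℕ} (h : i ≠ g.target) : g.act s i = s i := by
  simp [act, h]

theorem act_tof_target (i j k : ℕ) (s : ℕ → Bool) :
    (tof i j k).act s k = xor (s k) (s i && s j) := by
  simp [act, target, fires]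

end WireGate

/-- Action of a list of gates, the head being applied first. -/
def wireAct (C : List WireGate) (s : ℕ → Bool) : ℕ → Bool := C.foldl (fun s g => g.act s) s

@[simp] theorem wireAct_nil (s : ℕ → Bool) : wireAct [] s = s := rfl

@[simp] theorem wireAct_cons (g : WireGate) (C : List WireGate) (s : ℕ → Bool) :
    wireAct (g :: C) s = wireAct C (g.act s) := rfl

@[simp] theorem wireAct_append (C D : List WireGate) (s : ℕ → Bool) :
    wireAct (C ++ D) s = wireAct D (wireAct C s) := by simp [wireAct]

theorem wireAct_of_ne (C : List WireGate) (s : ℕ → Bool) {i : ℕ} (h : ∀ g ∈ C, i ≠ g.target) :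
    wireAct C s i = s i := by
  induction C generalizing s with
  | nil => rfl
  | cons g C ih =>
    rw [wireAct_cons, ih _ fun g hg => h g (by simp [hg]), g.act_of_ne _ (h g (by simp))]

/-- A list of valid gates as a reversible circuit on `N` bits. -/
def toRevCircuit {N : ℕ} (C : List WireGate) (h : ∀ g ∈ C, g.Valid N) : List (RevGate N) :=
  C.pmap (fun g hg => g.toRev hg) h

theorem encode_toRevCircuit {N : ℕ} (C : List WireGate) (h : ∀ g ∈ C, g.Valid N) :
    (toRevCircuit C h).map RevGate.encode = C.map WireGate.encode := by
  simp [toRevCircuit, List.map_pmap, WireGate.encode_toRev, List.pmap_eq_map]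

theorem revApply_toRevCircuit {N : ℕ} (C : List WireGate) (h : ∀ g ∈ C, g.Valid N)
    (s : ℕ → Bool) :
    revApply (toRevCircuit C h) (fun i : Fin N => s i) = fun i : Fin N => wireAct C s i := by
  induction C generalizing s with
  | nil => rfl
  | cons g C ih =>
    have := ih (fun g hg => h g (by simp [hg])) (g.act s)
    rw [wireAct_cons, ← this, ← g.apply_toRev (h g (by simp))]
    rfl

/-! ### Multiply controlled NOT gates with uninitialized work bits -/

/-- The product of `v` and the values of the `m` wires from `A` on. -/
def wireProd (s : ℕ → Bool) (A : ℕ) (v : Bool) : ℕ → Bool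
  | 0 => v
  | m + 1 => s (A + m) && wireProd s A v m

theorem wireProd_eq (s : ℕ → Bool) (A : ℕ) (v : Bool) (m : ℕ) :
    wireProd s A v m = (v && decide (∀ i < m, s (A + i) = true)) := by
  induction m with
  | zero => simp [wireProd]
  | succ m ih =>
    rw [wireProd, ih, Bool.eq_iff_iff]
    simp only [Bool.and_eq_true, decide_eq_true_eq, Nat.lt_succ_iff_lt_or_eq, or_imp, forall_and,
      forall_eq]
    tauto

theorem wireProd_congr {s s' : ℕ → Bool} {A m : ℕ} (v : Bool)
    (h : ∀ i, A ≤ i → i < A + m → s i = s' i) : wireProd s A v m = wireProd s' A v m := by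
  induction m with
  | zero => rfl
  | succ m ih =>
    rw [wireProd, wireProd, ih fun i hi hi' => h i hi (by omega), h _ (by omega) (by omega)]

/-- Gates that, for each `i ≤ m`, add to the wire `B + i` the product of the wires `A, …, A + i - 1`
and of the control of the gate `base`. -/
def cascade (A B : ℕ) (base : WireGate) : ℕ → List WireGate
  | 0 => [base]
  | m + 1 => .tof (A + m) (B + m) (B + m + 1) ::
      (cascade A B base m ++ [.tof (A + m) (B + m) (B + m + 1)])

/-- Induction on `m`: the two outer Toffoli gates read the wire `B + m` before and after the product
P has been added to it. Their sum is x y + x (y + P) = x P modulo 2, whatever the initial value y.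
-/
theorem wireAct_cascade (A B : ℕ) (base : WireGate) (m : ℕ) (hB : base.target = B)
    (hbase : ∀ s s' : ℕ → Bool, (∀ i, i < B ∨ B + m < i → s i = s' i) →
      base.fires s = base.fires s') (hAB : A + m ≤ B ∨ B + m < A) (s : ℕ → Bool) :
    wireAct (cascade A B base m) s = fun i =>
      if B ≤ i ∧ i ≤ B + m then xor (s i) (wireProd s A (base.fires s) (i - B)) else s i := by
  induction m generalizing s with
  | zero =>
    funext i
    simp only [cascade, wireAct_cons, wireAct_nil, WireGate.act, hB, Function.update_apply]
    by_cases h : i = B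
    · subst h; simp [wireProd]
    · rw [if_neg h, if_neg (by omega)]
  | succ m ih =>
    have ih := ih (fun s s' h => hbase s s' fun i hi => h i (by omega)) (by omega)
    simp only [cascade, wireAct_cons, wireAct_append, wireAct_nil, ih]
    set s₁ := (WireGate.tof (A + m) (B + m) (B + m + 1)).act s with hs₁
    have h₁ : ∀ i, i ≠ B + m + 1 → s₁ i = s i := fun i hi => WireGate.act_of_ne _ _ hi
    have hf : base.fires s₁ = base.fires s := hbase _ _ fun i hi => h₁ i (by omega)
    have hp : ∀ j ≤ m + 1, wireProd s₁ A (base.fires s) j = wireProd s A (base.fires s) j :=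
      fun j hj => wireProd_congr _ fun i hi hi' => h₁ i (by omega)
    funext i
    rw [hf]
    by_cases hi : i = B + m + 1
    · subst hi
      have hA : ¬(B ≤ A + m ∧ A + m ≤ B + m) := by omega
      have hBm : ¬(B ≤ B + m + 1 ∧ B + m + 1 ≤ B + m) := by omega
      have hBm' : B ≤ B + m + 1 ∧ B + m + 1 ≤ B + (m + 1) := by omega
      rw [WireGate.act_tof_target]
      simp only [if_neg hA, if_neg hBm, if_pos hBm']
      rw [if_pos (by omega), h₁ (A + m) (by omega), h₁ (B + m) (by omega),
        show B + m + 1 - B = m + 1 by omega, show B + m - B = m by omega, hp m (by omega),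
        wireProd, hs₁, WireGate.act_tof_target]
      cases s (A + m) <;> cases s (B + m) <;> simp
    · rw [WireGate.act_of_ne _ _ hi]
      by_cases hi' : B ≤ i ∧ i ≤ B + m
      · rw [if_pos hi', if_pos (by omega), h₁ i hi, hp _ (by omega)]
      · rw [if_neg hi', if_neg (by omega), h₁ i hi]

/-- Gates that add to the wire `t` the product of the wires `A, …, A + m` and of the control of the
gate `base`, with the wires `B, …, B + m` for work bits in an arbitrary state. -/
def multiNot (A B : ℕ) (base : WireGate) (m t : ℕ) : List WireGate :=
  .tof (A + m) (B + m) t :: (cascade A B base m ++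
    .tof (A + m) (B + m) t :: cascade A B base m)

/-- The identity x y + x (y + P) = x P is used once more, now on the target `t`. The second cascade
adds the same products again and so restores the borrowed wires; this requires that `base` reads
neither them nor `t`. -/
theorem wireAct_multiNot (A B : ℕ) (base : WireGate) (m t : ℕ) (hB : base.target = B)
    (hbase : ∀ s s' : ℕ → Bool, (∀ i, i < B ∨ B + m < i → i ≠ t → s i = s' i) →
      base.fires s = base.fires s') (hAB : A + m < B ∨ B + m < A)
    (htA : t < A ∨ A + m < t) (htB : t < B ∨ B + m < t) (s : ℕ → Bool) :
    wireAct (multiNot A B base m t) s =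
      Function.update s t (xor (s t) (wireProd s A (base.fires s) (m + 1))) := by
  have hc := wireAct_cascade A B base m hB (fun s s' h => hbase s s' fun i hi _ => h i hi)
    (by omega)
  simp only [multiNot, wireAct_cons, wireAct_append]
  rw [hc, hc]
  set s₁ := (WireGate.tof (A + m) (B + m) t).act s with hs₁
  have h₁ : ∀ i, i ≠ t → s₁ i = s i := fun i hi => WireGate.act_of_ne _ _ hi
  have hf : base.fires s₁ = base.fires s := hbase _ _ fun i _ hi => h₁ i hi
  have hp : ∀ j ≤ m + 1, wireProd s₁ A (base.fires s) j = wireProd s A (base.fires s) j :=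
    fun j hj => wireProd_congr _ fun i hi hi' => h₁ i (by omega)
  rw [hf]
  set s₂ : ℕ → Bool := fun i => if B ≤ i ∧ i ≤ B + m then
    xor (s₁ i) (wireProd s₁ A (base.fires s) (i - B)) else s₁ i with hs₂
  have h₂ : ∀ i, i < B ∨ B + m < i → s₂ i = s₁ i := fun i hi => if_neg (by omega)
  set s₃ := (WireGate.tof (A + m) (B + m) t).act s₂ with hs₃
  have h₃ : ∀ i, i ≠ t → s₃ i = s₂ i := fun i hi => WireGate.act_of_ne _ _ hi
  have hf₃ : base.fires s₃ = base.fires s :=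
    hbase _ _ fun i hi hi' => by rw [h₃ i hi', h₂ i hi, h₁ i hi']
  have hp₃ : ∀ j ≤ m + 1, wireProd s₃ A (base.fires s) j = wireProd s A (base.fires s) j :=
    fun j hj => wireProd_congr _ fun i hi hi' => by
      rw [h₃ i (by omega), h₂ i (by omega), h₁ i (by omega)]
  rw [hf₃]
  funext i
  by_cases hi : i = t
  · subst hi
    have hi' : ¬(B ≤ i ∧ i ≤ B + m) := by omega
    have hBm : s₂ (B + m) = xor (s₁ (B + m)) (wireProd s₁ A (base.fires s) m) := by
      rw [hs₂]
      simp only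
      rw [if_pos (by omega), Nat.add_sub_cancel_left]
    rw [if_neg hi', Function.update_self, hs₃, WireGate.act_tof_target, h₂ _ htB,
      h₂ (A + m) (by omega), h₁ (A + m) (by omega), hBm, h₁ (B + m) (by omega), hp _ (by omega),
      wireProd, hs₁, WireGate.act_tof_target]
    cases s (A + m) <;> cases s (B + m) <;> simp
  · rw [Function.update_of_ne hi, h₃ i hi]
    by_cases hi' : B ≤ i ∧ i ≤ B + m
    · rw [if_pos hi', hp₃ _ (by omega), hs₂]
      simp only
      rw [if_pos hi', hp _ (by omega), h₁ i hi]
      simp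
    · rw [if_neg hi', h₂ i (by omega), h₁ i hi]

/-! ### The reversible circuit of a Boolean circuit

A circuit with `n` inputs and `k` gates gets `n + 2 k + 5` wires: the inputs and the gates keep their
wires, the wires `n + k` and `n + k + 1` serve as scratch, the wire `n + 2 k + 2` is an uninitialized
work bit, the wire `n + 2 k + 3` carries the phase, and the last wire is a flag. The remaining wires
are padding. -/

/-- Gates that set the last wire if the wires `n, …, n + 2 k + 3`, except possibly the wire
`n + 2 k + 2`, are all set. -/
def flagCircuit (n k : ℕ) : List WireGate :=
  let flag := multiNot (n + k + 1) n (.tof (n + 2 * k + 2) (n + 2 * k + 3) n) k (n + 2 * k + 4)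
  flag ++ (multiNot n (n + k + 1) (.not (n + k + 1)) k (n + 2 * k + 2) ++ flag)

/-- The condition under which `flagCircuit` sets the flag. -/
def Flagged (n k : ℕ) (s : ℕ → Bool) : Prop :=
  (∀ i, n ≤ i → i < n + 2 * k + 2 → s i = true) ∧ s (n + 2 * k + 3) = true

/-- Let a and b be the conjunctions over the two halves of the work wires, p the phase wire and d
the free wire. The outer blocks add b p d and b p (d + a) to the flag, since the middle block
replaces d by d + a. The sum is a b p, independent of d, and only the free wire is left altered. -/
theorem wireAct_flagCircuit (n k : ℕ) (s : ℕ → Bool) (hs : s (n + 2 * k + 4) = false) :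
    (∀ i, i ≠ n + 2 * k + 2 → i ≠ n + 2 * k + 4 → wireAct (flagCircuit n k) s i = s i) ∧
    (wireAct (flagCircuit n k) s (n + 2 * k + 4) = true ↔ Flagged n k s) := by
  have hz : ∀ s, wireAct (multiNot (n + k + 1) n (.tof (n + 2 * k + 2) (n + 2 * k + 3) n) k
      (n + 2 * k + 4)) s = _ := fun s => wireAct_multiNot (n + k + 1) n
    (.tof (n + 2 * k + 2) (n + 2 * k + 3) n) k (n + 2 * k + 4) rfl
    (fun s s' h => by
      simp only [WireGate.fires]
      rw [h (n + 2 * k + 2) (by omega) (by omega), h (n + 2 * k + 3) (by omega) (by omega)])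
    (by omega) (by omega) (by omega) s
  have hd : ∀ s, wireAct (multiNot n (n + k + 1) (.not (n + k + 1)) k (n + 2 * k + 2)) s = _ :=
    fun s => wireAct_multiNot n (n + k + 1) (.not (n + k + 1)) k (n + 2 * k + 2) rfl
      (fun s s' h => rfl) (by omega) (by omega) (by omega) s
  simp only [flagCircuit, wireAct_append, hz, hd]
  constructor
  · intro i h₁ h₂
    simp [h₁, h₂]
  · have hF : Flagged n k s ↔ (∀ i < k + 1, s (n + i) = true) ∧
        (∀ i < k + 1, s (n + k + 1 + i) = true) ∧ s (n + 2 * k + 3) = true := by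
      constructor
      · exact fun h => ⟨fun i hi => h.1 _ (by omega) (by omega),
          fun i hi => h.1 _ (by omega) (by omega), h.2⟩
      · rintro ⟨h₁, h₂, h₃⟩
        refine ⟨fun i hi hi' => ?_, h₃⟩
        by_cases h : i < n + k + 1
        · rw [show i = n + (i - n) by omega]; exact h₁ _ (by omega)
        · rw [show i = n + k + 1 + (i - (n + k + 1)) by omega]; exact h₂ _ (by omega)
    rw [hF]
    set a : Bool := decide (∀ i < k + 1, s (n + i) = true) with ha
    set b : Bool := decide (∀ i < k + 1, s (n + k + 1 + i) = true) with hb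
    have e₁ : ∀ v, wireProd s (n + k + 1) v (k + 1) = (v && b) := fun v => wireProd_eq _ _ _ _
    have e₂ : ∀ w v', wireProd (Function.update s (n + 2 * k + 4) w) n v' (k + 1) = (v' && a) :=
      fun w v' => by
        rw [ha, ← wireProd_eq]
        exact wireProd_congr _ fun i _ _ => Function.update_of_ne (by omega) _ _
    have e₃ : ∀ w w' v', wireProd (Function.update (Function.update s (n + 2 * k + 4) w)
        (n + 2 * k + 2) w') (n + k + 1) v' (k + 1) = (v' && b) :=
      fun w w' v' => by
        rw [← e₁]
        exact wireProd_congr _ fun i _ _ => by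
          rw [Function.update_of_ne (by omega), Function.update_of_ne (by omega)]
    have n₁ : n + 2 * k + 2 ≠ n + 2 * k + 4 := by omega
    have n₂ : n + 2 * k + 3 ≠ n + 2 * k + 4 := by omega
    have n₃ : n + 2 * k + 3 ≠ n + 2 * k + 2 := by omega
    rw [Function.update_self, Function.update_of_ne n₁.symm, Function.update_self]
    rw [e₃, e₂, e₁]
    simp only [WireGate.fires, Function.update_self, Function.update_of_ne n₁,
      Function.update_of_ne n₂, Function.update_of_ne n₃, hs]
    have ha' : (∀ i < k + 1, s (n + i) = true) ↔ a = true := by simp [ha]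
    have hb' : (∀ i < k + 1, s (n + k + 1 + i) = true) ↔ b = true := by simp [hb]
    rw [ha', hb']
    cases a <;> cases b <;> cases s (n + 2 * k + 2) <;> cases s (n + 2 * k + 3) <;> simp

/-- Gates that compute a Boolean gate on the wire `t`, if the wires `t`, `a`, `b`, `z` are set. -/
def compileGate {m : ℕ} (a b z t : ℕ) : BoolGate m → List WireGate
  | .and i j => [.tof i z a, .tof j z b, .tof a b t, .tof j z b, .tof i z a, .tof i z t, .tof j z t]
  | .or i j => [.tof i z a, .tof j z b, .tof a b t, .tof j z b, .tof i z a]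
  | .not i => [.tof i z t]

/-- Gates that compute all wires of a Boolean circuit. -/
def compileGates {n : ℕ} (a b z : ℕ) : {k : ℕ} → BoolGates n k → List WireGate
  | _, .empty => []
  | k + 1, .snoc g h => compileGates a b z g ++ compileGate a b z (n + k) h

/-- With `z = 1` a Toffoli gate is a controlled NOT, so `a` and `b` turn from 1 into the negated
inputs and `t` becomes 1 + ¬i ∧ ¬j = i ∨ j. Adding i and j modulo 2 turns this into i ∧ j. The
detour through `a` and `b` also handles gates that read the same wire twice, where a direct Toffoli
gate would have equal controls. -/
theorem wireAct_compileGate {m : ℕ} {a b z t : ℕ} (g : BoolGate m) (s : ℕ → Bool)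
    (hm : m ≤ t) (hta : t < a) (htb : t < b) (htz : t < z) (hab : a ≠ b) (haz : a ≠ z) (hbz : b ≠ z)
    (ht : s t = true) (ha : s a = true) (hb : s b = true) (hz : s z = true) :
    wireAct (compileGate a b z t g) s = Function.update s t (g.eval fun i => s i) := by
  have key : ∀ i : Fin m, (i : ℕ) ≠ a ∧ (i : ℕ) ≠ b ∧ (i : ℕ) ≠ z ∧ (i : ℕ) ≠ t := fun i => by omega
  cases g with
  | not i =>
    obtain ⟨i₁, i₂, i₃, i₄⟩ := key i
    funext l
    by_cases h : l = t
    · subst h; simp [compileGate, WireGate.act, WireGate.target, WireGate.fires, BoolGate.eval, *]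
    · simp [compileGate, WireGate.act, WireGate.target, h]
  | and i j =>
    obtain ⟨i₁, i₂, i₃, i₄⟩ := key i
    obtain ⟨j₁, j₂, j₃, j₄⟩ := key j
    funext l
    simp only [compileGate, wireAct_cons, wireAct_nil, WireGate.act, WireGate.target,
      WireGate.fires, BoolGate.eval, Function.update_apply, i₁, i₂, i₄, j₁, j₂, j₄, hab,
      hab.symm, haz.symm, hbz.symm, hta.ne, htb.ne, hta.ne', htb.ne', htz.ne',
      if_false, if_true, ht, ha, hb, hz]
    split_ifs
    all_goals simp_all
    all_goals cases s i <;> cases s j <;> rfl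
  | or i j =>
    obtain ⟨i₁, i₂, i₃, i₄⟩ := key i
    obtain ⟨j₁, j₂, j₃, j₄⟩ := key j
    funext l
    simp only [compileGate, wireAct_cons, wireAct_nil, WireGate.act, WireGate.target,
      WireGate.fires, BoolGate.eval, Function.update_apply, i₁, i₂, i₄, j₁, j₂, j₄, hab,
      hab.symm, haz.symm, hbz.symm, hta.ne, htb.ne, hta.ne', htb.ne', htz.ne',
      if_false, if_true, ht, ha, hb, hz]
    split_ifs <;> simp_all

/-- The invariant is that all wires not yet assigned, including the scratch wires and the flag `z`,
still hold 1; only the unconstrained wire `d` is exempt. -/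
theorem wireAct_compileGates {n k d e a b z : ℕ} (g : BoolGates n k) (s : ℕ → Bool)
    (hka : n + k ≤ a) (hkb : n + k ≤ b) (hkz : n + k ≤ z) (hkd : n + k ≤ d)
    (hab : a ≠ b) (haz : a ≠ z) (hbz : b ≠ z) (had : a ≠ d) (hbd : b ≠ d) (hzd : z ≠ d)
    (hae : a < e) (hbe : b < e) (hze : z < e) (hs : ∀ i, n ≤ i → i < e → i ≠ d → s i = true) :
    (∀ i : Fin (n + k), wireAct (compileGates a b z g) s i = g.wires (fun i => s i) i) ∧
    ∀ i, n + k ≤ i → i < e → i ≠ d → wireAct (compileGates a b z g) s i = true := by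
  induction g with
  | empty => exact ⟨fun i => rfl, hs⟩
  | @snoc k g h ih =>
    obtain ⟨ih₁, ih₂⟩ := ih (by omega) (by omega) (by omega) (by omega)
    rw [compileGates, wireAct_append, wireAct_compileGate h _ le_rfl (by omega) (by omega)
      (by omega) hab haz hbz (ih₂ _ le_rfl (by omega) (by omega))
      (ih₂ _ (by omega) hae had) (ih₂ _ (by omega) hbe hbd) (ih₂ _ (by omega) hze hzd)]
    constructor
    · intro i
      rcases Fin.eq_castSucc_or_eq_last (n := n + k) i with ⟨i, rfl⟩ | rfl
      · have := i.2
        rw [BoolGates.wires, Fin.snoc_castSucc, Fin.val_castSucc,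
          Function.update_of_ne (by omega), ih₁]
      · rw [BoolGates.wires, Fin.val_last, Function.update_self]
        exact (congrArg (h.eval ·) (funext ih₁)).trans
          (Fin.snoc_last (α := fun _ => Bool) _ _).symm
    · intro i hi hie hid
      rw [Function.update_of_ne (by omega), ih₂ i (by omega) hie hid]

/-- The reversible circuit that computes the Boolean circuit `f` on the wire `n + 2 k + 3`. -/
def BoolCircuit.compile {n : ℕ} (f : BoolCircuit n) : List WireGate :=
  flagCircuit n f.size ++
    (compileGates (n + f.size) (n + f.size + 1) (n + 2 * f.size + 4) f.gates ++
      [.tof f.out (n + 2 * f.size + 4) (n + 2 * f.size + 3)])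

/-- Ensures that evaluating the circuit never changes the flag. -/
theorem target_mem_compileGates {n k a b z : ℕ} (g : BoolGates n k) :
    ∀ h ∈ compileGates a b z g, h.target = a ∨ h.target = b ∨ h.target < n + k := by
  induction g with
  | empty => simp [compileGates]
  | snoc g h ih =>
    intro h' hh'
    rw [compileGates, List.mem_append] at hh'
    rcases hh' with hh' | hh'
    · have := ih _ hh'
      omega
    · cases h <;> simp only [compileGate, List.mem_cons, List.not_mem_nil, or_false] at hh' <;>
        rcases hh' with rfl | rfl | rfl | rfl | rfl | rfl | rfl <;> simp [WireGate.target]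

theorem BoolCircuit.wireAct_compile {n : ℕ} (f : BoolCircuit n) (s : ℕ → Bool)
    (hs : s (n + 2 * f.size + 4) = false) :
    (wireAct f.compile s (n + 2 * f.size + 4) = true ↔ Flagged n f.size s) ∧
    (Flagged n f.size s →
      wireAct f.compile s (n + 2 * f.size + 3) = !f.eval fun i => s i) := by
  have hout := f.out.2
  obtain ⟨h₁, h₂⟩ := wireAct_flagCircuit n f.size s hs
  set s₁ := wireAct (flagCircuit n f.size) s with hs₁
  set gs := compileGates (n + f.size) (n + f.size + 1) (n + 2 * f.size + 4) f.gates with hgs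
  have hc : wireAct f.compile s = _ := wireAct_append _ _ _
  rw [← hs₁, wireAct_append, ← hgs, wireAct_cons, wireAct_nil] at hc
  constructor
  · rw [hc, WireGate.act_of_ne _ _ (by simp [WireGate.target]),
      wireAct_of_ne _ _ fun g hg => ?_, h₂]
    have := target_mem_compileGates _ _ hg
    omega
  · intro hf
    have hs₁' : ∀ i, n ≤ i → i < n + 2 * f.size + 5 → i ≠ n + 2 * f.size + 2 → s₁ i = true := by
      intro i hi hi' hid
      by_cases hz : i = n + 2 * f.size + 4
      · rw [hz]; exact h₂.2 hf
      · rw [h₁ i hid hz]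
        by_cases hb : i = n + 2 * f.size + 3
        · rw [hb]; exact hf.2
        · exact hf.1 i hi (by omega)
    obtain ⟨g₁, g₂⟩ := wireAct_compileGates (d := n + 2 * f.size + 2) (a := n + f.size)
      (b := n + f.size + 1) (z := n + 2 * f.size + 4) f.gates s₁ (by omega) (by omega) (by omega)
      (by omega) (by omega) (by omega) (by omega) (by omega) (by omega) (by omega) (by omega)
      (by omega) (by omega) hs₁'
    rw [← hgs] at g₁ g₂
    rw [hc, WireGate.act_tof_target, g₁ f.out, g₂ _ (by omega) (by omega) (by omega),
      g₂ _ (by omega) (by omega) (by omega), Bool.and_true, Bool.true_xor, BoolCircuit.eval]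
    congr 2
    funext i
    exact h₁ i (by omega) (by omega)

/-! ### Validity and number of the gates. -/

theorem valid_of_mem_cascade {A B N m : ℕ} {base : WireGate} (hA : A + m ≤ N) (hB : B + m < N)
    (hAB : A + m ≤ B ∨ B + m < A) (hbase : base.Valid N) :
    ∀ g ∈ cascade A B base m, g.Valid N := by
  induction m with
  | zero => simpa [cascade] using hbase
  | succ m ih =>
    have ih := ih (by omega) (by omega) (by omega)
    have hg : (WireGate.tof (A + m) (B + m) (B + m + 1)).Valid N := by
      simp only [WireGate.Valid]; omega
    simp only [cascade, List.mem_cons, List.mem_append, List.not_mem_nil, or_false]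
    rintro g (rfl | h | rfl)
    exacts [hg, ih g h, hg]

theorem valid_of_mem_multiNot {A B N m t : ℕ} {base : WireGate} (hA : A + m < N) (hB : B + m < N)
    (ht : t < N) (hAB : A + m < B ∨ B + m < A) (htA : t < A ∨ A + m < t) (htB : t < B ∨ B + m < t)
    (hbase : base.Valid N) : ∀ g ∈ multiNot A B base m t, g.Valid N := by
  have hc := valid_of_mem_cascade (A := A) (m := m) (by omega) hB (by omega) hbase
  have hg : (WireGate.tof (A + m) (B + m) t).Valid N := by
    simp only [WireGate.Valid]; omega
  simp only [multiNot, List.mem_cons, List.mem_append]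
  rintro g (rfl | h | rfl | h)
  exacts [hg, hc g h, hg, hc g h]

theorem valid_of_mem_flagCircuit {n k N : ℕ} (hN : n + 2 * k + 4 < N) :
    ∀ g ∈ flagCircuit n k, g.Valid N := by
  have h₁ := valid_of_mem_multiNot (A := n + k + 1) (B := n) (N := N) (m := k)
    (t := n + 2 * k + 4) (base := .tof (n + 2 * k + 2) (n + 2 * k + 3) n) (by omega) (by omega)
    (by omega) (by omega) (by omega) (by omega) (by simp only [WireGate.Valid]; omega)
  have h₂ := valid_of_mem_multiNot (A := n) (B := n + k + 1) (N := N) (m := k)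
    (t := n + 2 * k + 2) (base := .not (n + k + 1)) (by omega) (by omega)
    (by omega) (by omega) (by omega) (by omega) (by simp only [WireGate.Valid]; omega)
  simp only [flagCircuit, List.mem_append]
  rintro g (h | h | h)
  exacts [h₁ g h, h₂ g h, h₁ g h]

theorem valid_of_mem_compileGates {n k a b z N : ℕ} (g : BoolGates n k) (ha : a < N) (hb : b < N)
    (hz : z < N) (hab : a ≠ b) (haz : a ≠ z) (hbz : b ≠ z) (hka : n + k ≤ a) (hkb : n + k ≤ b)
    (hkz : n + k ≤ z) : ∀ h ∈ compileGates a b z g, h.Valid N := by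
  induction g with
  | empty => simp [compileGates]
  | @snoc k g h ih =>
    intro h' hh'
    rw [compileGates, List.mem_append] at hh'
    rcases hh' with hh' | hh'
    · exact ih (by omega) (by omega) (by omega) _ hh'
    · cases h <;> simp only [compileGate, List.mem_cons, List.not_mem_nil, or_false] at hh' <;>
        rcases hh' with rfl | rfl | rfl | rfl | rfl | rfl | rfl <;> simp only [WireGate.Valid] <;>
        omega

theorem BoolCircuit.valid_of_mem_compile {n N : ℕ} (f : BoolCircuit n)
    (hN : n + 2 * f.size + 4 < N) : ∀ g ∈ f.compile, g.Valid N := by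
  have hout := f.out.2
  simp only [compile, List.mem_append, List.mem_singleton]
  rintro g (h | h | rfl)
  · exact valid_of_mem_flagCircuit hN g h
  · exact valid_of_mem_compileGates f.gates (by omega) (by omega) (by omega) (by omega) (by omega)
      (by omega) (by omega) (by omega) (by omega) g h
  · simp only [WireGate.Valid]; omega

theorem length_cascade (A B : ℕ) (base : WireGate) (m : ℕ) :
    (cascade A B base m).length = 2 * m + 1 := by
  induction m with
  | zero => rfl
  | succ m ih => simp [cascade, ih]; omega

theorem length_compileGates_le {n k a b z : ℕ} (g : BoolGates n k) :
    (compileGates a b z g).length ≤ 7 * k := by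
  induction g with
  | empty => simp [compileGates]
  | snoc g h ih => cases h <;> simp [compileGates, compileGate] <;> omega

theorem BoolCircuit.length_compile_le {n : ℕ} (f : BoolCircuit n) :
    f.compile.length ≤ 19 * f.size + 13 := by
  -- The three multiply controlled NOT gates have 4k + 4 gates each, the Boolean gates cost at most
  -- 7k, and one gate writes the phase.
  have := length_compileGates_le (a := n + f.size) (b := n + f.size + 1)
    (z := n + 2 * f.size + 4) f.gates
  simp only [compile, flagCircuit, multiNot, List.length_append, List.length_cons, length_cascade,
    List.length_nil]
  omega

/-- The HC1Q model of a Boolean circuit. All qubits are measured, and the result is `1` on the last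
two of them. -/
def BoolCircuit.model {n : ℕ} (f : BoolCircuit n) : HC1Q (n + (2 * f.size + 3) + 2) where
  circuit := toRevCircuit f.compile (f.valid_of_mem_compile (by omega))
  accept i := some (decide (n + 2 * f.size + 3 ≤ i))

/-! ### The acceptance probability -/

theorem HC1Q.acceptProb_of_accept {N : ℕ} (Q : HC1Q N) (r : Fin N → Bool)
    (h : ∀ i, Q.accept i = some (r i)) : Q.acceptProb = ‖Q.finalState r‖ ^ 2 := by
  classical
  have : ∀ y : Fin N → Bool, (∀ i : Fin N, ∀ b : Bool, Q.accept i = some b → y i = b) ↔ y = r := by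
    intro y
    simp [h, funext_iff]
  simp only [HC1Q.acceptProb, this, Finset.sum_ite_eq', Finset.mem_univ, if_true]

theorem hadamardLayer_ketZero {M : ℕ} (u : Fin (M + 1) → Bool) :
    hadamardLayer (M + 1) u (fun _ => false) =
      if u (Fin.last M) = false then (1 / (Real.sqrt 2 : ℂ)) ^ M else 0 := by
  rw [hadamardLayer, Fin.prod_univ_castSucc]
  simp [hadamard, Matrix.one_apply]

theorem HC1Q.finalState_eq {M : ℕ} (Q : HC1Q (M + 1)) (y : Fin (M + 1) → Bool) :
    Q.finalState y = ∑ u : Fin (M + 1) → Bool,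
      hadamardLayer (M + 1) y (revApply Q.circuit u) *
        if u (Fin.last M) = false then (1 / (Real.sqrt 2 : ℂ)) ^ M else 0 := by
  rw [HC1Q.finalState, ketZero, Matrix.mulVec_single_one, Matrix.col_apply, Matrix.mul_apply]
  refine Finset.sum_congr rfl fun u _ => ?_
  rw [hadamardLayer_ketZero, Matrix.mul_apply]
  simp [revMatrix]

/-- The Hadamard row of result 0 is constant, that of result 1 yields the sign, and the last qubit
has no Hadamard gate and must agree. -/
theorem hadamardLayer_last_two {M : ℕ} (v : Fin (M + 2) → Bool) :
    hadamardLayer (M + 2) (fun i => decide (M ≤ i)) v =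
      if v (Fin.last (M + 1)) = true then
        (1 / (Real.sqrt 2 : ℂ)) ^ (M + 1) * (-1) ^ (v (Fin.last M).castSucc).toNat else 0 := by
  rw [hadamardLayer, Fin.prod_univ_castSucc, Fin.prod_univ_castSucc]
  have : ∀ i : Fin M, ¬ M ≤ i := fun i => by omega
  cases v (Fin.last (M + 1)) <;> cases v (Fin.last M).castSucc <;>
    simp [hadamard, Matrix.one_apply, this, pow_succ]

/-- The wires on the input `x`, with all work bits set except for the flag, and with the
uninitialized work bit `b`. -/
def flaggedState {n : ℕ} (k : ℕ) (x : Fin n → Bool) (b : Bool) (i : ℕ) : Bool :=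
  if h : i < n then x ⟨i, h⟩ else if i = n + 2 * k + 2 then b else decide (i ≠ n + 2 * k + 4)

/-- The surviving branches are parametrized by the input x and the free bit, which explains the
factor 2. The phase wire starts at 1 and ends as ¬f(x), which explains the sign. -/
theorem BoolCircuit.sum_flagged {n : ℕ} (f : BoolCircuit n) :
    (∑ u : Fin (n + (2 * f.size + 3) + 2) → Bool,
      if u (Fin.last _) = false ∧ revApply f.model.circuit u (Fin.last _) = true then
        (-1 : ℤ) ^ (revApply f.model.circuit u (Fin.last _).castSucc).toNat else 0) =
      -(2 * f.gap) := by
  have hgap : -(2 * f.gap) =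
      ∑ p : (Fin n → Bool) × Bool, -(-1 : ℤ) ^ (f.eval p.1).toNat := by
    rw [Fintype.sum_prod_type]
    simp [BoolCircuit.gap, Finset.mul_sum]
  rw [hgap]
  symm
  have ext : ∀ u : Fin (n + (2 * f.size + 3) + 2) → Bool,
      ∃ s : ℕ → Bool, u = fun i : Fin (n + (2 * f.size + 3) + 2) => s i := fun u =>
    ⟨fun i => if h : i < n + (2 * f.size + 3) + 2 then u ⟨i, h⟩ else false, by funext i; simp⟩
  have key : ∀ s : ℕ → Bool,
      revApply f.model.circuit (fun i : Fin (n + (2 * f.size + 3) + 2) => s i) =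
        fun i : Fin (n + (2 * f.size + 3) + 2) => wireAct f.compile s i := fun s =>
    revApply_toRevCircuit _ _ s
  refine Fintype.sum_of_injective
    (fun p (i : Fin (n + (2 * f.size + 3) + 2)) => flaggedState f.size p.1 p.2 i) ?_ _ _ ?_ ?_
  · rintro ⟨x, b⟩ ⟨x', b'⟩ h
    simp only at h
    refine Prod.ext (funext fun i => ?_) ?_
    · simpa [flaggedState] using congrFun h ⟨i, by omega⟩
    · have := congrFun h ⟨n + 2 * f.size + 2, by omega⟩
      simp only [flaggedState] at this
      rw [dif_neg (by omega), dif_neg (by omega)] at this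
      simpa using this
  · intro u hu
    obtain ⟨s, rfl⟩ := ext u
    rw [key]
    refine if_neg ?_
    rintro ⟨h₁, h₂⟩
    have h₁ : s (n + 2 * f.size + 4) = false := h₁
    have hF := (f.wireAct_compile s h₁).1.1 h₂
    refine hu ⟨⟨fun i => s i, s (n + 2 * f.size + 2)⟩, funext fun i => ?_⟩
    have hi := i.2
    simp only [flaggedState]
    by_cases hin : (i : ℕ) < n
    · rw [dif_pos hin]
    · rw [dif_neg hin]
      by_cases hid : (i : ℕ) = n + 2 * f.size + 2
      · rw [if_pos hid, hid]
      · rw [if_neg hid]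
        by_cases hiz : (i : ℕ) = n + 2 * f.size + 4
        · simp [hiz, h₁]
        · by_cases hib : (i : ℕ) = n + 2 * f.size + 3
          · simp [hib, hF.2]
          · simp [hiz, hF.1 i (by omega) (by omega)]
  · rintro ⟨x, b⟩
    simp only
    rw [key]
    set s := flaggedState f.size x b with hs
    have h₁ : s (n + 2 * f.size + 4) = false := by
      rw [hs, flaggedState, dif_neg (by omega), if_neg (by omega)]; simp
    have hF : Flagged n f.size s := by
      refine ⟨fun i hi hi' => ?_, ?_⟩ <;>
      · rw [hs, flaggedState, dif_neg (by omega), if_neg (by omega), decide_eq_true_eq]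
        omega
    obtain ⟨c₁, c₂⟩ := f.wireAct_compile s h₁
    rw [if_pos ⟨h₁, c₁.2 hF⟩]
    have hx : (fun i : Fin n => s i) = x := by
      funext i; simp [hs, flaggedState]
    have c₂ : wireAct f.compile s
        (Fin.last (n + (2 * f.size + 3))).castSucc = !f.eval x := by rw [← hx]; exact c₂ hF
    simp only [c₂]
    cases f.eval x <;> simp

theorem BoolCircuit.acceptProb_model {n : ℕ} (f : BoolCircuit n) :
    f.model.acceptProb = (f.gap : ℝ) ^ 2 / 2 ^ (2 * n + 2 * (2 * f.size + 3)) := by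
  rw [HC1Q.acceptProb_of_accept _ (fun i => decide (n + (2 * f.size + 3) ≤ i)) fun i => rfl,
    HC1Q.finalState_eq]
  set M := n + (2 * f.size + 3) with hM
  have h2 : (1 / (Real.sqrt 2 : ℂ)) ^ (M + 1) * (1 / (Real.sqrt 2 : ℂ)) ^ (M + 1) =
      1 / 2 ^ (M + 1) := by
    rw [← mul_pow, ← one_div_pow]
    congr 1
    rw [div_mul_div_comm, ← Complex.ofReal_mul, Real.mul_self_sqrt (by norm_num)]
    simp
  have hsum : (∑ u : Fin (M + 2) → Bool,
      hadamardLayer (M + 2) (fun i => decide (M ≤ i)) (revApply f.model.circuit u) *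
        if u (Fin.last (M + 1)) = false then (1 / (Real.sqrt 2 : ℂ)) ^ (M + 1) else 0) =
      ((-(2 * f.gap) : ℤ) : ℂ) / 2 ^ (M + 1) := by
    rw [← f.sum_flagged, Int.cast_sum, Finset.sum_div]
    refine Finset.sum_congr rfl fun u _ => ?_
    rw [hadamardLayer_last_two, div_eq_mul_one_div _ ((2 : ℂ) ^ (M + 1)), ← h2]
    by_cases h₁ : u (Fin.last (M + 1)) = false
    · by_cases h₂ : revApply f.model.circuit u (Fin.last (M + 1)) = true
      · rw [if_pos h₁, if_pos h₂, if_pos ⟨h₁, h₂⟩]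
        push_cast
        ring
      · rw [if_neg h₂, if_neg (not_and_of_not_right _ h₂)]
        simp
    · rw [if_neg h₁, if_neg (not_and_of_not_left _ h₁)]
      simp
  rw [hsum]
  -- The factor 2 from the free bit cancels one power of two, leaving `M` = n + ξ in the exponent.
  have : ((-(2 * f.gap) : ℤ) : ℂ) / 2 ^ (M + 1) = ((-(f.gap : ℝ) / 2 ^ M : ℝ) : ℂ) := by
    push_cast
    rw [pow_succ]
    field_simp
  rw [this, Complex.norm_real, Real.norm_eq_abs, sq_abs, div_pow, neg_sq, ← pow_mul, hM]
  congr 2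
  ring

/-! ### A program that writes down the HC1Q model of a Boolean circuit

The program uses the variable `0` only, which holds a list of registers. -/

namespace Expr

/-- The list of registers from the register `j` on. -/
def drop : ℕ → Expr
  | 0 => var 0
  | j + 1 => tl (drop j)

/-- The register `j`. -/
def reg (j : ℕ) : Expr := hd (drop j)

/-- Successor of a natural number. -/
def succ (e : Expr) : Expr := cons nil e

/-- Description of a TOFFOLI gate. -/
def tof (e₁ e₂ e₃ : Expr) : Expr := cons (succ nil) (cons e₁ (cons e₂ e₃))

/-- The list of given expressions, followed by `e`. -/
def list (l : List Expr) (e : Expr := nil) : Expr := l.foldr cons e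

end Expr

namespace Prog

open FineGrained.Expr (reg succ)

/-- Simultaneous assignment to all registers. -/
def setRegs (l : List Expr) : Prog := assign 0 (Expr.list l)

/-- Repeat as long as the register `0` is not `nil`. -/
def loopReg (c : Prog) : Prog := loop (reg 0) c

theorem transforms_loopReg_nil (c : Prog) (l : List Data) :
    (loopReg c).Transforms (Data.ofList (Data.nil :: l)) (Data.ofList (Data.nil :: l)) 3 :=
  Transforms.loop_done rfl

/-- The loop test costs 3 steps, and 500 is a uniform allowance for every loop body below. -/
theorem transforms_loopReg_cons {c : Prog} {x y d' d'' : Data} {l : List Data} {k : ℕ}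
    (h₁ : c.Transforms (Data.ofList (Data.cons x y :: l)) d' 500)
    (h₂ : (loopReg c).Transforms d' d'' (503 * k + 3)) :
    (loopReg c).Transforms (Data.ofList (Data.cons x y :: l)) d'' (503 * (k + 1) + 3) :=
  (Transforms.loop_step (by rintro ⟨⟩) h₁ h₂).mono (by
    have : (reg 0).cost = 2 := rfl
    omega)

/-- Count the elements of the list in register `0` with the registers `1` and `2`. -/
def countGates : Prog :=
  loopReg (setRegs [.tl (reg 0), succ (reg 1), succ (reg 2), reg 3, reg 4])

theorem transforms_countGates {n k : ℕ} (g : BoolGates n k) (a b : ℕ) (x y : Data) :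
    countGates.Transforms (Data.ofList [g.encode, Data.ofNat a, Data.ofNat b, x, y])
      (Data.ofList [Data.nil, Data.ofNat (a + k), Data.ofNat (b + k), x, y]) (503 * k + 3) := by
  induction g generalizing a b with
  | empty => exact transforms_loopReg_nil _ _
  | @snoc k g h ih =>
    rw [show a + (k + 1) = a + 1 + k by omega, show b + (k + 1) = b + 1 + k by omega]
    exact transforms_loopReg_cons (.assign rfl (by decide)) (ih (a + 1) (b + 1))

/-- Add the number in register `0` to the one in register `1`. -/
def addRegs : Prog :=
  loopReg (setRegs [.tl (reg 0), succ (reg 1), reg 2, reg 3, reg 4])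

theorem transforms_addRegs (k a : ℕ) (x y z : Data) :
    addRegs.Transforms (Data.ofList [Data.ofNat k, Data.ofNat a, x, y, z])
      (Data.ofList [Data.nil, Data.ofNat (a + k), x, y, z]) (503 * k + 3) := by
  induction k generalizing a with
  | zero => exact transforms_loopReg_nil _ _
  | succ k ih =>
    rw [show a + (k + 1) = a + 1 + k by omega]
    exact transforms_loopReg_cons (.assign rfl (by decide)) (ih (a + 1))

/-- Description of a list of gates. -/
def codes (C : List WireGate) : Data := Data.ofList (C.map WireGate.encode)

/-- Write down the gates of `compileGates`, from the last one to the first one. The registers hold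
the list of the Boolean gates, the number of wires, the first scratch wire, the list that is written,
and two parameters, the second one determining the flag wire. -/
def writeGates : Prog :=
  let h : Expr := reg 0 |>.hd
  let t : Expr := reg 1 |>.tl
  let a : Expr := reg 2
  let b : Expr := succ (reg 2)
  let z : Expr := succ (succ (reg 5))
  let i : Expr := h.tl.hd
  let j : Expr := h.tl.tl
  let write (l : List Expr) : Prog :=
    setRegs [.tl (reg 0), t, reg 2, Expr.list l (reg 3), reg 4, reg 5]
  loopReg (ite h.hd
    (ite h.hd.tl
      (write [.tof h.tl z t])
      (write [.tof i z a, .tof j z b, .tof a b t, .tof j z b, .tof i z a]))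
    (write [.tof i z a, .tof j z b, .tof a b t, .tof j z b, .tof i z a, .tof i z t, .tof j z t]))

theorem transforms_writeGates {n k : ℕ} (g : BoolGates n k) (a d : ℕ) (x : Data)
    (C : List WireGate) :
    writeGates.Transforms
      (Data.ofList [g.encode, Data.ofNat (n + k), Data.ofNat a, codes C, x, Data.ofNat d])
      (Data.ofList [Data.nil, Data.ofNat n, Data.ofNat a,
        codes (compileGates a (a + 1) (d + 2) g ++ C), x, Data.ofNat d]) (503 * k + 3) := by
  induction g generalizing C with
  | empty => exact transforms_loopReg_nil _ _
  | @snoc k g h ih =>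
    rw [compileGates, List.append_assoc]
    -- Descriptions list the last Boolean gate first, which is the order in which the output must be
    -- prepended.
    refine transforms_loopReg_cons ?_ (ih _)
    cases h with
    | and i j =>
      exact (Transforms.ite_false rfl (.assign (T := 450) rfl (by decide))).mono (by decide)
    | or i j =>
      exact (Transforms.ite_true (by rintro ⟨⟩) (Transforms.ite_false rfl
        (.assign (T := 450) rfl (by decide)))).mono (by decide)
    | not i =>
      exact (Transforms.ite_true (by rintro ⟨⟩) (Transforms.ite_true (by rintro ⟨⟩)
        (.assign (T := 450) rfl (by decide)))).mono (by decide)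

end Prog

/-- The nested definition unfolds to two plain loops around `base`, which a program can write one
after the other. -/
theorem cascade_eq (A B : ℕ) (base : WireGate) (m : ℕ) :
    cascade A B base m =
      (List.range m).reverse.map (fun i => .tof (A + i) (B + i) (B + i + 1)) ++
        base :: (List.range m).map fun i => .tof (A + i) (B + i) (B + i + 1) := by
  induction m with
  | zero => rfl
  | succ m ih => simp [cascade, ih, List.range_succ]

/-! ### Writing the cascades, the flag circuit and the whole model. -/

namespace Prog

open FineGrained.Expr (reg succ)

/-- Write down the second half of a cascade. The registers hold the number of gates, the ends of
the ranges of controls and of targets, the list that is written, and two parameters. -/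
def writeCascadeDown : Prog :=
  loopReg (setRegs [.tl (reg 0), .tl (reg 1), .tl (reg 2),
    .cons (.tof (.tl (reg 1)) (.tl (reg 2)) (reg 2)) (reg 3), reg 4, reg 5])

theorem transforms_writeCascadeDown (m A B : ℕ) (x y : Data) (C : List WireGate) :
    writeCascadeDown.Transforms
      (Data.ofList [Data.ofNat m, Data.ofNat (A + m), Data.ofNat (B + m), codes C, x, y])
      (Data.ofList [Data.nil, Data.ofNat A, Data.ofNat B,
        codes ((List.range m).map (fun i => .tof (A + i) (B + i) (B + i + 1)) ++ C), x, y])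
      (503 * m + 3) := by
  induction m generalizing C with
  | zero => exact transforms_loopReg_nil _ _
  | succ m ih =>
    rw [List.range_succ, List.map_append, List.append_assoc]
    exact transforms_loopReg_cons (.assign rfl (by decide))
      (ih (.tof (A + m) (B + m) (B + m + 1) :: C))

/-- Write down the first half of a cascade. -/
def writeCascadeUp : Prog :=
  loopReg (setRegs [.tl (reg 0), succ (reg 1), succ (reg 2),
    .cons (.tof (reg 1) (reg 2) (succ (reg 2))) (reg 3), reg 4, reg 5])

theorem transforms_writeCascadeUp (m A B : ℕ) (x y : Data) (C : List WireGate) :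
    writeCascadeUp.Transforms
      (Data.ofList [Data.ofNat m, Data.ofNat A, Data.ofNat B, codes C, x, y])
      (Data.ofList [Data.nil, Data.ofNat (A + m), Data.ofNat (B + m),
        codes ((List.range m).reverse.map (fun i => .tof (A + i) (B + i) (B + i + 1)) ++ C), x, y])
      (503 * m + 3) := by
  induction m generalizing A B C with
  | zero => exact transforms_loopReg_nil _ _
  | succ m ih =>
    -- Index 0 comes last in the reversed range, so it is written first; the remaining indices are
    -- shifted into `A + 1` and `B + 1`.
    have : (List.range (m + 1)).reverse.map
        (fun i => WireGate.tof (A + i) (B + i) (B + i + 1)) ++ C =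
        (List.range m).reverse.map (fun i => .tof (A + 1 + i) (B + 1 + i) (B + 1 + i + 1)) ++
          .tof A B (B + 1) :: C := by
      simp [List.range_succ_eq_map, Function.comp_def, add_assoc, add_comm, add_left_comm]
    rw [this, show A + (m + 1) = A + 1 + m by omega, show B + (m + 1) = B + 1 + m by omega]
    exact transforms_loopReg_cons (.assign rfl (by decide)) (ih (A + 1) (B + 1) (.tof A B (B + 1) :: C))

/-- Write down the gate that is the value of `e`, and set the register `0` to the value of `c`. -/
def writeGate (c e : Expr) : Prog := setRegs [c, reg 1, reg 2, .cons e (reg 3), reg 4, reg 5]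

theorem transforms_writeGate {c e : Expr} {v v' p q x y : Data} {g : WireGate} {C : List WireGate}
    (hcc : c.cost ≤ 10) (hec : e.cost ≤ 100)
    (hc : c.eval (init (Data.ofList [v, p, q, codes C, x, y])) = v')
    (he : e.eval (init (Data.ofList [v, p, q, codes C, x, y])) = g.encode) :
    (writeGate c e).Transforms (Data.ofList [v, p, q, codes C, x, y])
      (Data.ofList [v', p, q, codes (g :: C), x, y]) 200 := by
  refine .assign ?_ ?_
  · change Data.ofList [c.eval _, p, q, Data.cons (e.eval (init (Data.ofList
      [v, p, q, codes C, x, y]))) (codes C), x, y] = _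
    rw [hc, he]
    rfl
  · change c.cost + (3 + (4 + (e.cost + 5 + 1 + (6 + (7 + 1 + 1) + 1) + 1) + 1) + 1) + 1 + 1 ≤ 200
    omega

/-- Write down a cascade, whose number of gates is in register `4`. -/
def writeCascade (base : Expr) : Prog :=
  seq (setRegs [reg 4, reg 1, reg 2, reg 3, reg 4, reg 5]) (seq writeCascadeDown
    (seq (writeGate (reg 4) base) writeCascadeUp))

/-- Output is prepended, so the second half is written first. At that point registers `1` and `2`
have descended to `A` and `B`, where `base` is evaluated; the other half brings them back up. -/
theorem transforms_writeCascade {m A B : ℕ} {y : Data} {base : Expr} {g : WireGate}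
    (hc : base.cost ≤ 100) (hbase : ∀ acc, base.eval (init (Data.ofList
      [Data.nil, Data.ofNat A, Data.ofNat B, acc, Data.ofNat m, y])) = g.encode)
    (C : List WireGate) (c : Data) :
    (writeCascade base).Transforms
      (Data.ofList [c, Data.ofNat (A + m), Data.ofNat (B + m), codes C, Data.ofNat m, y])
      (Data.ofList [Data.nil, Data.ofNat (A + m), Data.ofNat (B + m),
        codes (cascade A B g m ++ C), Data.ofNat m, y]) (1006 * m + 406) := by
  rw [cascade_eq, List.append_assoc, List.cons_append]
  exact ((Transforms.assign (T := 200) rfl (by decide)).seq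
    ((transforms_writeCascadeDown m A B _ _ C).seq
      ((transforms_writeGate (by decide) hc rfl (hbase _)).seq
        (transforms_writeCascadeUp m A B _ _ (g :: _))))).mono (by omega)

/-- Write down a multiply controlled NOT gate with target `t`. -/
def writeMultiNot (base t : Expr) : Prog :=
  seq (writeCascade base) (seq (writeGate .nil (.tof (reg 1) (reg 2) t))
    (seq (writeCascade base) (writeGate .nil (.tof (reg 1) (reg 2) t))))

theorem transforms_writeMultiNot {m A B t : ℕ} {y : Data} {base te : Expr} {g : WireGate}
    (hc : base.cost ≤ 100) (hbase : ∀ acc, base.eval (init (Data.ofList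
      [Data.nil, Data.ofNat A, Data.ofNat B, acc, Data.ofNat m, y])) = g.encode)
    (htc : te.cost ≤ 20) (hte : ∀ acc, te.eval (init (Data.ofList
      [Data.nil, Data.ofNat (A + m), Data.ofNat (B + m), acc, Data.ofNat m, y])) = Data.ofNat t)
    (C : List WireGate) (c : Data) :
    (writeMultiNot base te).Transforms
      (Data.ofList [c, Data.ofNat (A + m), Data.ofNat (B + m), codes C, Data.ofNat m, y])
      (Data.ofList [Data.nil, Data.ofNat (A + m), Data.ofNat (B + m),
        codes (multiNot A B g m t ++ C), Data.ofNat m, y]) (2012 * m + 1212) := by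
  have hg : ∀ C, (writeGate .nil (.tof (reg 1) (reg 2) te)).Transforms
      (Data.ofList [Data.nil, Data.ofNat (A + m), Data.ofNat (B + m), codes C, Data.ofNat m, y])
      (Data.ofList [Data.nil, Data.ofNat (A + m), Data.ofNat (B + m),
        codes (.tof (A + m) (B + m) t :: C), Data.ofNat m, y]) 200 := fun C => by
    refine transforms_writeGate (by decide) ?_ rfl ?_
    · change 1 + 1 + 1 + (3 + (4 + te.cost + 1) + 1) + 1 ≤ 100
      omega
    · change Data.cons _ (Data.cons _ (Data.cons _ (te.eval _))) = _
      rw [hte]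
      rfl
  rw [multiNot, List.cons_append, List.append_assoc, List.cons_append]
  exact ((transforms_writeCascade hc hbase C c).seq ((hg _).seq
    ((transforms_writeCascade hc hbase _ _).seq (hg _)))).mono (by omega)

/-- Write down the gates of `flagCircuit`. -/
def writeFlagCircuit : Prog :=
  let flag : Prog := seq (setRegs [.nil, .tl (reg 5), reg 2, reg 3, reg 4, reg 5])
    (writeMultiNot (.tof (reg 5) (succ (reg 5)) (reg 2)) (succ (succ (reg 5))))
  seq flag (seq (seq (setRegs [.nil, reg 2, .tl (reg 5), reg 3, reg 4, reg 5])
    (writeMultiNot (.cons .nil (reg 2)) (reg 5)))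
    (seq (setRegs [.nil, reg 1, reg 1, reg 3, reg 4, reg 5]) flag))

theorem transforms_writeFlagCircuit (n k : ℕ) (C : List WireGate) (c p : Data) :
    writeFlagCircuit.Transforms
      (Data.ofList [c, p, Data.ofNat (n + k), codes C, Data.ofNat k, Data.ofNat (n + 2 * k + 2)])
      (Data.ofList [Data.nil, Data.ofNat (n + k + 1 + k), Data.ofNat (n + k),
        codes (flagCircuit n k ++ C), Data.ofNat k, Data.ofNat (n + 2 * k + 2)])
      (6036 * k + 6000) := by
  -- In this form the predecessor of register `5` is visibly the upper end of the second half of the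
  -- work wires.
  have e : n + 2 * k + 2 = n + k + 1 + k + 1 := by omega
  have flag : ∀ (C : List WireGate) (c p : Data),
      (seq (setRegs [.nil, .tl (reg 5), reg 2, reg 3, reg 4, reg 5])
        (writeMultiNot (.tof (reg 5) (succ (reg 5)) (reg 2)) (succ (succ (reg 5))))).Transforms
      (Data.ofList [c, p, Data.ofNat (n + k), codes C, Data.ofNat k, Data.ofNat (n + 2 * k + 2)])
      (Data.ofList [Data.nil, Data.ofNat (n + k + 1 + k), Data.ofNat (n + k),
        codes (multiNot (n + k + 1) n (.tof (n + 2 * k + 2) (n + 2 * k + 3) n) k (n + 2 * k + 4) ++ C),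
        Data.ofNat k, Data.ofNat (n + 2 * k + 2)]) (2012 * k + 1412) := fun C c p =>
    ((Transforms.assign (T := 200) (by rw [e]; rfl) (by decide)).seq
      (transforms_writeMultiNot (by decide) (fun _ => rfl) (by decide) (fun _ => rfl) C
        Data.nil)).mono (by omega)
  have free : ∀ (C : List WireGate) (c p : Data),
      (seq (setRegs [.nil, reg 2, .tl (reg 5), reg 3, reg 4, reg 5])
        (writeMultiNot (.cons .nil (reg 2)) (reg 5))).Transforms
      (Data.ofList [c, p, Data.ofNat (n + k), codes C, Data.ofNat k, Data.ofNat (n + 2 * k + 2)])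
      (Data.ofList [Data.nil, Data.ofNat (n + k), Data.ofNat (n + k + 1 + k),
        codes (multiNot n (n + k + 1) (.not (n + k + 1)) k (n + 2 * k + 2) ++ C),
        Data.ofNat k, Data.ofNat (n + 2 * k + 2)]) (2012 * k + 1412) := fun C c p =>
    ((Transforms.assign (T := 200) (by rw [e]; rfl) (by decide)).seq
      (transforms_writeMultiNot (by decide) (fun _ => rfl) (by decide) (fun _ => rfl) C
        Data.nil)).mono (by omega)
  rw [flagCircuit]
  simp only [List.append_assoc]
  exact ((flag C c p).seq ((free _ _ _).seq
    ((Transforms.assign (T := 200) rfl (by decide)).seq (flag _ _ _)))).mono (by omega)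

/-- Write down the measurement result `0` for as many qubits as the number in register `0`. -/
def writeResults : Prog :=
  loopReg (setRegs [.tl (reg 0), .cons (succ .nil) (reg 1), reg 2, reg 3])

theorem transforms_writeResults (m : ℕ) (l : List Data) (x y : Data) :
    writeResults.Transforms (Data.ofList [Data.ofNat m, Data.ofList l, x, y])
      (Data.ofList [Data.nil, Data.ofList (List.replicate m (Data.ofNat 1) ++ l), x, y])
      (503 * m + 3) := by
  induction m generalizing l with
  | zero => exact transforms_loopReg_nil _ _
  | succ m ih =>
    rw [List.replicate_succ', List.append_assoc]
    exact transforms_loopReg_cons (.assign rfl (by decide)) (ih (Data.ofNat 1 :: l))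

/-- Write down the HC1Q model of a Boolean circuit. -/
def writeModel : Prog :=
  seq (setRegs [reg 1, reg 0, .nil, reg 1, .drop 2]) <| seq countGates <|
  seq (setRegs [reg 2, succ (succ (reg 1)), .cons (reg 1) (reg 2), reg 3, reg 4]) <| seq addRegs <|
  seq (setRegs [reg 3, .hd (reg 2), .hd (reg 2),
    .list [.tof (reg 4) (succ (succ (reg 1))) (succ (reg 1))], .tl (reg 2), reg 1]) <|
  seq writeGates <| seq writeFlagCircuit <|
  seq (setRegs [succ (reg 5), .list [succ (succ .nil), succ (succ .nil)], reg 3, reg 5]) <|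
  seq writeResults (assign 0 (.cons (succ (succ (succ (reg 3)))) (.cons (reg 2) (reg 1))))

end Prog

theorem BoolCircuit.encode_model {n : ℕ} (f : BoolCircuit n) :
    f.model.encode = Data.cons (Data.ofNat (n + 2 * f.size + 5)) (Data.cons (Prog.codes f.compile)
      (Data.ofList (List.replicate (n + 2 * f.size + 3) (Data.ofNat 1) ++
        [Data.ofNat 2, Data.ofNat 2]))) := by
  have hl : List.ofFn (fun i => HC1Q.encodeResult (f.model.accept i)) =
      List.replicate (n + 2 * f.size + 3) (Data.ofNat 1) ++ [Data.ofNat 2, Data.ofNat 2] := by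
    refine List.ext_getElem (by simp) fun i h₁ h₂ => ?_
    rw [List.getElem_ofFn]
    by_cases h : i < n + 2 * f.size + 3
    · rw [List.getElem_append_left (by simpa using h)]
      simp [BoolCircuit.model, HC1Q.encodeResult, Nat.not_le.2 h]
    · rw [List.getElem_append_right (by simpa using h)]
      simp only [List.length_ofFn] at h₁
      have : i = n + 2 * f.size + 3 ∨ i = n + 2 * f.size + 3 + 1 := by omega
      rcases this with rfl | rfl <;> simp [BoolCircuit.model, HC1Q.encodeResult]
  rw [HC1Q.encode, hl, BoolCircuit.model, encode_toRevCircuit]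
  rfl

namespace Prog
open FineGrained.Expr (reg succ)

theorem transforms_writeModel {n : ℕ} (f : BoolCircuit n) :
    writeModel.Transforms f.encode f.model.encode (20000 * (n + f.size + 1)) := by
  rw [f.encode_model]
  obtain ⟨k, g, out⟩ := f
  have h₁ := transforms_countGates g n 0 g.encode (Data.ofNat out)
  have h₂ := transforms_addRegs k (n + k + 2) (Data.cons (Data.ofNat (n + k)) (Data.ofNat k))
    g.encode (Data.ofNat out)
  have h₃ := transforms_writeGates g (n + k) (n + 2 * k + 2) (Data.ofNat k)
    [.tof out (n + 2 * k + 4) (n + 2 * k + 3)]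
  have h₄ := transforms_writeFlagCircuit n k
    (compileGates (n + k) (n + k + 1) (n + 2 * k + 4) g ++
      [.tof out (n + 2 * k + 4) (n + 2 * k + 3)]) Data.nil (Data.ofNat n)
  have h₅ := transforms_writeResults (n + 2 * k + 3) [Data.ofNat 2, Data.ofNat 2]
    (codes (BoolCircuit.compile ⟨k, g, out⟩)) (Data.ofNat (n + 2 * k + 2))
  rw [Nat.zero_add] at h₁
  rw [show n + k + 2 + k = n + 2 * k + 2 by omega] at h₂
  exact ((Transforms.assign (T := 200) rfl (by decide)).seq <| h₁.seq <|
    (Transforms.assign (T := 200) rfl (by decide)).seq <| h₂.seq <|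
    (Transforms.assign (T := 200) rfl (by decide)).seq <| h₃.seq <| h₄.seq <|
    (Transforms.assign (T := 200) rfl (by decide)).seq <| h₅.seq
    (Transforms.assign (T := 200) rfl (by decide))).mono (by dsimp only; omega)

end Prog

/-! ### Descriptions of Boolean circuits -/

theorem Data.ofNat_injective : Function.Injective Data.ofNat := by
  intro a
  induction a with
  | zero => rintro (_ | b) h <;> simp_all [Data.ofNat]
  | succ a ih =>
    rintro (_ | b) h
    · simp [Data.ofNat] at h
    · simp only [Data.ofNat, Data.cons.injEq, true_and] at h
      rw [ih h]

theorem BoolGate.encode_injective {m : ℕ} : Function.Injective (BoolGate.encode (m := m)) := by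
  intro g h e
  cases g <;> cases h <;> simp [encode, Data.ofNat, Data.ofNat_injective.eq_iff, Fin.ext_iff] at e ⊢
  all_goals exact e

theorem BoolGates.encode_injective {n k l : ℕ} (g : BoolGates n k) (h : BoolGates n l)
    (e : g.encode = h.encode) : (⟨k, g⟩ : Σ k, BoolGates n k) = ⟨l, h⟩ := by
  induction g generalizing l with
  | empty => cases h with
    | empty => rfl
    | snoc => simp [encode] at e
  | snoc g b ih => cases h with
    | empty => simp [encode] at e
    | snoc h b' =>
      simp only [encode, Data.cons.injEq] at e
      cases ih h e.2
      rw [BoolGate.encode_injective e.1]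

/-- Makes the hard-coded answer attached to a description well defined. -/
theorem BoolCircuit.encode_injective {n m : ℕ} (f : BoolCircuit n) (g : BoolCircuit m)
    (e : f.encode = g.encode) : (⟨n, f⟩ : Σ n, BoolCircuit n) = ⟨m, g⟩ := by
  obtain ⟨k, f, o⟩ := f
  obtain ⟨l, g, o'⟩ := g
  simp only [encode, Data.cons.injEq, Data.ofNat_injective.eq_iff] at e
  obtain ⟨rfl, e₁, e₂⟩ := e
  cases BoolGates.encode_injective f g e₁
  rw [Fin.ext e₂]

instance (m : ℕ) : Finite (BoolGate m) :=
  Finite.of_injective (β := Fin 3 × Fin m × Fin m)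
    (fun g => match g with
      | .and i j => (0, i, j)
      | .or i j => (1, i, j)
      | .not i => (2, i, i)) fun g h e => by
    cases g <;> cases h <;> simp_all

instance (n k : ℕ) : Finite (BoolGates n k) := by
  induction k with
  | zero =>
    exact Finite.of_injective (fun _ => ()) fun g h _ => by cases g; cases h; rfl
  | succ k ih =>
    exact Finite.of_surjective (fun p : BoolGates n k × BoolGate (n + k) => p.1.snoc p.2) fun g => by
      cases g with
      | snoc g h => exact ⟨(g, h), rfl⟩

/-- There are finitely many circuits of bounded size with a bounded number of inputs. -/
theorem finite_encode (n₀ : ℕ) (p : ℕ → ℕ) :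
    {d : Data | ∃ n < n₀, ∃ f : BoolCircuit n, f.size ≤ p n ∧ f.encode = d}.Finite := by
  have : {d : Data | ∃ n < n₀, ∃ f : BoolCircuit n, f.size ≤ p n ∧ f.encode = d} =
      ⋃ n ∈ Finset.range n₀, ⋃ k ∈ Finset.range (p n + 1),
        Set.range fun q : BoolGates n k × Fin (n + k) => (BoolCircuit.mk k q.1 q.2).encode := by
    ext d
    simp only [Set.mem_ofPred_eq, Set.mem_iUnion, Finset.mem_range, Set.mem_range, Prod.exists,
      exists_prop]
    constructor
    · rintro ⟨n, hn, f, hf, rfl⟩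
      exact ⟨n, hn, f.size, by omega, f.gates, f.out, rfl⟩
    · rintro ⟨n, hn, k, hk, g, o, rfl⟩
      exact ⟨n, hn, ⟨k, g, o⟩, by simpa using Nat.lt_succ_iff.1 hk, rfl⟩
  rw [this]
  exact Set.Finite.biUnion (Finset.finite_toSet _) fun n _ =>
    Set.Finite.biUnion (Finset.finite_toSet _) fun k _ => Set.finite_range _

/-! ### Growth -/

theorem isLittleO_polynomial_rpow (p : Polynomial ℕ) {b : ℝ} (hb : 0 < b) :
    (fun n : ℕ => ((p.eval n : ℕ) : ℝ)) =o[atTop] fun n : ℕ => (2 : ℝ) ^ (b * (n : ℝ)) := by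
  have h2 : ∀ n : ℕ, (2 : ℝ) ^ (b * (n : ℝ)) = ((2 : ℝ) ^ b) ^ n := fun n => by
    rw [Real.rpow_mul (by norm_num), Real.rpow_natCast]
  simp only [h2]
  induction p using Polynomial.induction_on' with
  | add p q hp hq => simpa using hp.add hq
  | monomial k c =>
    simpa using (isLittleO_pow_const_const_pow_of_one_lt k
      (Real.one_lt_rpow one_lt_two hb)).const_mul_left (c : ℝ)

theorem eventually_polynomial_add_rpow_le (p : Polynomial ℕ) {a b c : ℝ} (hb : b < 1)
    (hab : b < a) (hbc : c = 1 - b) :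
    ∀ᶠ n : ℕ in atTop,
      ((p.eval n : ℕ) : ℝ) + (2 : ℝ) ^ ((1 - a) * (n : ℝ)) ≤ (2 : ℝ) ^ (c * (n : ℝ)) := by
  subst hbc
  have h₁ := (isLittleO_polynomial_rpow p (sub_pos.2 hb)).bound (c := 1 / 2) (by norm_num)
  -- The constant polynomial 1 gives 1 ≤ 2^((a - b) n) / 2, so each summand is at most half of the
  -- right-hand side.
  have h₂ := (isLittleO_polynomial_rpow 1 (sub_pos.2 hab)).bound (c := 1 / 2) (by norm_num)
  filter_upwards [h₁, h₂] with n h₁ h₂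
  have e : (2 : ℝ) ^ ((1 - b) * (n : ℝ)) = 2 ^ ((1 - a) * (n : ℝ)) * 2 ^ ((a - b) * (n : ℝ)) := by
    rw [← Real.rpow_add (by norm_num)]; congr 1; ring
  have hpos : (0 : ℝ) < 2 ^ ((1 - a) * (n : ℝ)) := by positivity
  have hpos' : (0 : ℝ) < 2 ^ ((1 - b) * (n : ℝ)) := by positivity
  have hpos'' : (0 : ℝ) < 2 ^ ((a - b) * (n : ℝ)) := by positivity
  rw [Real.norm_of_nonneg (by positivity), Real.norm_of_nonneg hpos'.le] at h₁
  rw [Real.norm_of_nonneg (by positivity), Real.norm_of_nonneg hpos''.le] at h₂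
  simp only [Polynomial.eval_one, Nat.cast_one] at h₂
  nlinarith

/-! ### The reduction -/

/-- If a probabilistic program samples the acceptance probabilities of the models of all but finitely
many circuits, then some non-deterministic program, almost as fast, decides whether the gap vanishes. -/
theorem exists_prog_of_samples (p : ℕ → ℕ) (S : Prog) (τ : ℕ → ℝ) (hτ : ∀ n, 0 ≤ τ n) {ε : ℝ}
    (hε : ε < 1)
    (n₀ : ℕ) (hS : ∀ n ≥ n₀, ∀ f : BoolCircuit n, f.size ≤ p n →
      S.Samples f.model.encode f.model.acceptProb (τ n) ε) :
    ∃ (A : Prog) (K : ℕ), ∀ (n : ℕ) (f : BoolCircuit n), f.size ≤ p n →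
      A.HaltsWithin f.encode ((20000 * (n + p n + 1) + K : ℕ) + τ n) ∧
        (A.NAccepts f.encode ↔ f.gap ≠ 0) := by
  classical
  let ans : Data → Bool := fun d => decide (∃ (n : ℕ) (f : BoolCircuit n), f.encode = d ∧ f.gap ≠ 0)
  have hans : ∀ {n : ℕ} (f : BoolCircuit n), ans f.encode = true ↔ f.gap ≠ 0 := fun {n} f => by
    simp only [ans, decide_eq_true_eq]
    constructor
    · rintro ⟨m, g, e, hg⟩
      cases BoolCircuit.encode_injective g f e
      exact hg
    · exact fun h => ⟨n, f, rfl, h⟩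
  obtain ⟨K, hK⟩ := Prog.run_table ans (finite_encode n₀ p).toFinset.toList
    (Prog.seq Prog.writeModel S)
  set A := Prog.table ans (finite_encode n₀ p).toFinset.toList (Prog.seq Prog.writeModel S)
  refine ⟨A, K, fun n f hf => ?_⟩
  by_cases hd : f.encode ∈ (finite_encode n₀ p).toFinset.toList
  · have hrun := fun ω => (hK f.encode ω 0).1 hd
    constructor
    · intro ω
      obtain ⟨t, ht, hr⟩ := hrun ω
      refine ⟨_, _, _, hr, ?_⟩
      have : (t : ℝ) ≤ (20000 * (n + p n + 1) + K : ℕ) := by exact_mod_cast (by omega)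
      linarith [hτ n]
    · have hval : Prog.init (Data.ofBool (ans f.encode)) 0 ≠ Data.nil ↔ f.gap ≠ 0 := by
        rw [← hans f]
        cases ans f.encode <;> simp [Prog.init, Data.ofBool]
      rw [← hval]
      constructor
      · rintro ⟨ω, s, j, t, hr, hs⟩
        obtain ⟨t', -, hr'⟩ := hrun ω
        rwa [(hr'.det hr).1]
      · intro h
        obtain ⟨t', -, hr'⟩ := hrun fun _ => false
        exact ⟨_, _, _, _, hr', h⟩
  · have hn : n₀ ≤ n := by
      by_contra hn
      refine hd ?_
      simp only [Finset.mem_toList, Set.Finite.mem_toFinset, Set.mem_ofPred_eq]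
      exact ⟨n, not_le.1 hn, f, hf, rfl⟩
    have hs := hS n hn f hf
    have hgap : S.NAccepts f.model.encode ↔ f.gap ≠ 0 := by
      rw [hs.nAccepts_iff (by rw [f.acceptProb_model]; positivity) hε, f.acceptProb_model]
      simp
    -- The translation uses no tosses, so `S` starts at toss 0 with the same ω and from a clean
    -- initial store.
    have hrun : ∀ (ω : ℕ → Bool) (s : Store) (j t : ℕ),
        Prog.Run ω S (Prog.init f.model.encode) 0 s j t →
        ∃ t' ≤ 20000 * (n + p n + 1) + K + t, Prog.Run ω A (Prog.init f.encode) 0 s j t' := by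
      intro ω s j t hr
      obtain ⟨t₁, ht₁, hr₁⟩ := Prog.transforms_writeModel f ω 0
      obtain ⟨t', ht', hr'⟩ := (hK f.encode ω 0).2 hd s j _ (hr₁.seq hr)
      exact ⟨t', by omega, hr'⟩
    constructor
    · intro ω
      obtain ⟨s, j, t, hr, ht⟩ := hs.1 ω
      obtain ⟨t', ht', hr'⟩ := hrun ω s j t hr
      refine ⟨s, j, t', hr', ?_⟩
      have : (t' : ℝ) ≤ (20000 * (n + p n + 1) + K : ℕ) + t := by exact_mod_cast ht'
      linarith
    · rw [← hgap]
      constructor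
      · rintro ⟨ω, s, j, t, hr, hs'⟩
        -- Since `S` halts on ω, determinism identifies the accepting run of `A` with the extension
        -- of that run of `S`.
        obtain ⟨s₁, j₁, t₁, hr₁, -⟩ := hs.1 ω
        obtain ⟨t', -, hr'⟩ := hrun ω s₁ j₁ t₁ hr₁
        obtain ⟨rfl, -, -⟩ := hr.det hr'
        exact ⟨ω, _, _, _, hr₁, hs'⟩
      · rintro ⟨ω, s, j, t, hr, hs'⟩
        obtain ⟨t', -, hr'⟩ := hrun ω s j t hr
        exact ⟨ω, s, j, t', hr', hs'⟩

end FineGrained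

/-! ### The hardness theorem. -/

open FineGrained
theorem theorem4 (hconj : GapConjecture) :
    ∀ a : ℝ, 0 < a → ∃ q : Polynomial ℕ,
      ∀ (ε : ℝ), ε < 1 → ∀ S : Prog,
        ∃ᶠ n : ℕ in Filter.atTop,
          ∃ (f : BoolCircuit n) (ξ : ℕ) (Q : HC1Q (n + ξ + 2)),
            f.size ≤ q.eval n ∧
            n + ξ + 2 ≤ q.eval n ∧
            Q.circuit.length ≤ q.eval n ∧
            Q.acceptProb = (f.gap : ℝ) ^ 2 / 2 ^ (2 * n + 2 * ξ) ∧
            ¬ S.Samples Q.encode Q.acceptProb ((2 : ℝ) ^ ((1 - a) * (n : ℝ))) ε := by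
  intro a ha
  have hmin : 0 < min a 1 := lt_min ha one_pos
  have hmina : min a 1 ≤ a := min_le_left _ _
  have hmin1 : min a 1 ≤ 1 := min_le_right _ _
  -- The exponent b = min(a, 1)/2 satisfies b < a, to dominate 2^((1 - a) n), and b < 1, so that
  -- 2^((1 - b) n) outgrows the polynomial overhead.
  obtain ⟨p, hp⟩ := hconj (min a 1 / 2) (by linarith)
  -- This bounds at once the size k ≤ p(n), the n + 2k + 5 qubits and the at most 19k + 13
  -- reversible gates.
  refine ⟨19 * p + Polynomial.X + 13, fun ε hε S => ?_⟩
  have hq : ∀ n, (19 * p + Polynomial.X + 13 : Polynomial ℕ).eval n = 19 * p.eval n + n + 13 := by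
    intro n; simp
  by_contra hcon
  rw [Filter.not_frequently, Filter.eventually_atTop] at hcon
  obtain ⟨n₀, hn₀⟩ := hcon
  obtain ⟨A, K, hA⟩ := exists_prog_of_samples (fun n => p.eval n) S
    (fun n => (2 : ℝ) ^ ((1 - a) * (n : ℝ))) (fun n => by positivity) hε n₀ (by
      intro n hn f hf
      by_contra hs
      have hlen : f.model.circuit.length ≤ 19 * f.size + 13 := by
        simpa [BoolCircuit.model, toRevCircuit] using f.length_compile_le
      exact hn₀ n hn ⟨f, 2 * f.size + 3, f.model, by rw [hq]; omega, by rw [hq]; omega,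
        by rw [hq]; omega, f.acceptProb_model, hs⟩)
  refine hp A _ hA ?_
  filter_upwards [eventually_polynomial_add_rpow_le
    (20000 * (Polynomial.X + p + 1) + (K : Polynomial ℕ)) (a := a) (b := min a 1 / 2)
    (by linarith) (by linarith) rfl] with n hn
  simpa using hn
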